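/- Let $g\ge 1$ and let $\Gamma$ be a chain of $g$ loops with bridges: for $1\le i\le g$ the $i$th loop consists of two edges of lengths $\ell_i,m_i>0$ joining the vertices $v_i$ and $w_i$, and for $1\le i<g$ a bridge of positive length joins $w_i$ to $v_{i+1}$. Assume that the edge lengths are generic: no $\ell_i/m_i$ equals the ratio of two positive integers whose sum is at most $2g-2$. Piecewise linear functions on $\Gamma$ are continuous with integer slopes; $\operatorname{div}(\varphi)=\sum_v \operatorname{ord}_v(\varphi)\,v$, where $\operatorname{ord}_v(\varphi)$ is the sum of the incoming slopes of $\varphi$ at $v$; divisors $D,D'$ on $\Gamma$ are equivalent if $D'=D+\operatorname{div}(\varphi)$ for a piecewise linear $\varphi$; $D$ has rank at least $r$ if $D-F$ is equivalent to an effective divisor for every effective divisor $F$ of degree $r$; and $K_\Gamma=\sum_v(\deg(v)-2)\,v$. A finite family $(\theta_a)_a$ of functions on $\Gamma$ is tropically dependent if there are real numbers $b_a$ such that at every point of $\Gamma$ the minimum of the $\theta_a+b_a$ is attained for at least two indices $a$, and tropically independent otherwise. Let $r\ge 0$ and $d$ be integers with $\rho(g,r,d)=g-(r+1)(g-d+r)=0$.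 Let $D$ be a divisor on $\Gamma$ of degree $d$ and rank at least $r$ (for example the $v_1$-reduced one in its class), and let $E$ be a divisor equivalent to $K_\Gamma-D$. Then: (1) For each $0\le j\le r$ there is a unique divisor $D_j$ equivalent to $D$ such that $D_j-jv_1-(r-j)w_g$ is effective, and for each $0\le k\le g-d+r-1$ there is a unique divisor $E_k$ equivalent to $E$ such that $E_k-kv_1-(g-d+r-1-k)w_g$ is effective. (2) Let $\varphi_j,\psi_k$ be piecewise linear functions with $D+\operatorname{div}(\varphi_j)=D_j$ and $E+\operatorname{div}(\psi_k)=E_k$. Then the family of the $(r+1)(g-d+r)=g$ functions $\varphi_j+\psi_k$ is tropically independent. (3) Consequently the multiplication (Petri) map is injective whenever $\varphi_j$ and $\psi_k$ are the tropicalizations of bases: let $L/K$ be a field extension, $\operatorname{val}$ a valuation on $K$ with values in $\mathbb R\cup\{\infty\}$ and, for each $p\in\Gamma$, let $\operatorname{val}_p$ be a valuation on $L$ extending $\operatorname{val}$ (for example, $L$ is the function field of a curve $X$ and $\Gamma$ is the skeleton of $X^{\mathrm{an}}$). Let $A,B\subset L$ be $K$-subspaces (for example $\mathcal L(D_X)$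 and $\mathcal L(K_X-D_X)$) with bases $f_0,\dots,f_r$ and $g_0,\dots,g_{g-d+r-1}$ such that $\operatorname{val}_p(f_j)=\varphi_j(p)$ and $\operatorname{val}_p(g_k)=\psi_k(p)$ for all $p\in\Gamma$ and all $j,k$. Then the multiplication map $A\otimes_K B\to L$ is injective. -/

import Mathlib

open Filter Topology

noncomputable section

/-- A finite metric graph: finitely many vertices and edges, every edge `e` being identified with
the segment `[0, len e]`, glued at `0` to `src e` and at `len e` to `tgt e`. -/
structure MetricGraph where
  V : Type
  E : Type
  [fintypeV : Fintype V]
  [fintypeE : Fintype E]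
  src : E → V
  tgt : E → V
  len : E → ℝ
  len_pos : ∀ e, 0 < len e

namespace MetricGraph

attribute [instance] MetricGraph.fintypeV MetricGraph.fintypeE

variable (G : MetricGraph)

/-- The points of the metric graph: its vertices and the interior points of its edges. -/
inductive Point : Type
  | vertex (v : G.V) : Point
  | interior (e : G.E) (x : ℝ) (h0 : 0 < x) (h1 : x < G.len e) : Point

/-- The point at distance `x` from `src e` along the edge `e`, for `0 ≤ x ≤ len e`. -/
def pt (e : G.E) (x : ℝ) : G.Point :=
  if h0 : 0 < x then
    if h1 : x < G.len e then Point.interior e x h0 h1 else Point.vertex (G.tgt e)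
  else Point.vertex (G.src e)

end MetricGraph

/-- Immediately to the right of `x`, the function `u` is linear with slope `n`. -/
def HasRightSlope (u : ℝ → ℝ) (x : ℝ) (n : ℤ) : Prop :=
  ∀ᶠ y in 𝓝[>] x, u y = u x + n * (y - x)

/-- Immediately to the left of `x`, the function `u` is linear with slope `n`. -/
def HasLeftSlope (u : ℝ → ℝ) (x : ℝ) (n : ℤ) : Prop :=
  ∀ᶠ y in 𝓝[<] x, u y = u x + n * (y - x)

open Classical in
/-- The integer slope of `u` to the right of `x` (zero if there is none). -/
def rightSlope (u : ℝ → ℝ) (x : ℝ) : ℤ :=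
  if h : ∃ n, HasRightSlope u x n then h.choose else 0

open Classical in
/-- The integer slope of `u` to the left of `x` (zero if there is none). -/
def leftSlope (u : ℝ → ℝ) (x : ℝ) : ℤ :=
  if h : ∃ n, HasLeftSlope u x n then h.choose else 0

namespace MetricGraph

variable (G : MetricGraph)

/-- Continuous piecewise linear functions with integer slopes. On every (compact) edge we ask that
the function is linear with integer slope on a one-sided neighbourhood of every point, on either
side; by compactness there are finitely many pieces, and continuity is automatic. -/
def IsPL (f : G.Point → ℝ) : Prop :=
  ∀ e : G.E,
    (∀ x, 0 ≤ x → x < G.len e → ∃ n, HasRightSlope (fun y => f (G.pt e y)) x n) ∧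
    (∀ x, 0 < x → x ≤ G.len e → ∃ n, HasLeftSlope (fun y => f (G.pt e y)) x n)

open Classical in
/-- The order of a piecewise linear function at a point: the sum of its incoming slopes. -/
def ord (f : G.Point → ℝ) : G.Point → ℤ
  | .vertex v =>
      (∑ e : G.E, if G.src e = v then -rightSlope (fun y => f (G.pt e y)) 0 else 0) +
      ∑ e : G.E, if G.tgt e = v then leftSlope (fun y => f (G.pt e y)) (G.len e) else 0
  | .interior e x _ _ =>
      leftSlope (fun y => f (G.pt e y)) x - rightSlope (fun y => f (G.pt e y)) x

/-- Divisors: finite formal integer combinations of points. `0 ≤ D` says that `D` is effective. -/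
abbrev Divisor : Type := G.Point →₀ ℤ

variable {G}

/-- The degree of a divisor. -/
def degree (D : G.Divisor) : ℤ := D.sum fun _ a => a

/-- `f` is a piecewise linear function with `D + div f = D'`. -/
def Moves (f : G.Point → ℝ) (D D' : G.Divisor) : Prop :=
  G.IsPL f ∧ ∀ p, D p + G.ord f p = D' p

/-- Linear equivalence of divisors. -/
def Equivalent (D D' : G.Divisor) : Prop := ∃ f, Moves f D D'

/-- The divisor `D` has rank at least `r`. -/
def RankAtLeast (D : G.Divisor) (r : ℕ) : Prop :=
  ∀ F : G.Divisor, 0 ≤ F → degree F = r → ∃ D' : G.Divisor, 0 ≤ D' ∧ Equivalent (D - F) D'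

variable (G) in
open Classical in
/-- The valence of a vertex (an edge with both ends at `v` counts twice). -/
def valence (v : G.V) : ℕ :=
  (∑ e : G.E, if G.src e = v then 1 else 0) + ∑ e : G.E, if G.tgt e = v then 1 else 0

variable (G) in
/-- The canonical divisor `∑ (valence v - 2) v`; interior points of edges have valence two. -/
def canonical : G.Divisor :=
  ∑ v : G.V, Finsupp.single (Point.vertex v) ((G.valence v : ℤ) - 2)

/-- A family of functions is tropically dependent if, after adding suitable constants, the minimum
is attained at least twice at every point. -/
def TropicallyDependent {ι : Type*} (F : ι → G.Point → ℝ) : Prop :=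
  ∃ b : ι → ℝ, ∀ p : G.Point, ∃ a a' : ι, a ≠ a' ∧
    (∀ c, F a p + b a ≤ F c p + b c) ∧ (∀ c, F a' p + b a' ≤ F c p + b c)

/-- Tropical independence. -/
def TropicallyIndependent {ι : Type*} (F : ι → G.Point → ℝ) : Prop := ¬ TropicallyDependent F

end MetricGraph

/-- The edge lengths of a chain of `g` loops with bridges. The vertices are `v i` and `w i` for
`i : Fin g`; the `i`th loop consists of two edges from `v i` to `w i`, of lengths `ell i` and `m i`;
the `i`th bridge joins `w i` to `v (i + 1)`. Indices start at zero. -/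
structure ChainOfLoops (g : ℕ) where
  ell : Fin g → ℝ
  m : Fin g → ℝ
  bridge : Fin (g - 1) → ℝ
  ell_pos : ∀ i, 0 < ell i
  m_pos : ∀ i, 0 < m i
  bridge_pos : ∀ i, 0 < bridge i

namespace ChainOfLoops

open MetricGraph

variable {g : ℕ} (C : ChainOfLoops g)

/-- The chain of loops as a metric graph. Vertices: `inl i` is `v i` and `inr i` is `w i`. Edges:
`inl i` and `inr (inl i)` form the `i`th loop, `inr (inr i)` is the `i`th bridge. -/
def graph : MetricGraph where
  V := Fin g ⊕ Fin g
  E := Fin g ⊕ Fin g ⊕ Fin (g - 1)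
  src := Sum.elim (fun i => Sum.inl i)
    (Sum.elim (fun i => Sum.inl i) (fun i => Sum.inr ⟨i.1, by have := i.2; omega⟩))
  tgt := Sum.elim (fun i => Sum.inr i)
    (Sum.elim (fun i => Sum.inr i) (fun i => Sum.inl ⟨i.1 + 1, by have := i.2; omega⟩))
  len := Sum.elim C.ell (Sum.elim C.m C.bridge)
  len_pos := by
    rintro (i | i | i)
    · exact C.ell_pos i
    · exact C.m_pos i
    · exact C.bridge_pos i

/-- The left-most vertex, on the first loop. -/
def leftEnd (hg : 0 < g) : C.graph.Point := Point.vertex (Sum.inl (⟨0, hg⟩ : Fin g))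

/-- The right-most vertex, on the last loop. -/
def rightEnd (hg : 0 < g) : C.graph.Point :=
  Point.vertex (Sum.inr (⟨g - 1, by omega⟩ : Fin g))

/-- Generic edge lengths: no ratio `ell i / m i` is a ratio of two positive integers with sum at
most `2 * g - 2`. -/
def Generic : Prop :=
  ∀ i : Fin g, ∀ a b : ℕ, 0 < a → 0 < b → a + b ≤ 2 * g - 2 → C.ell i / C.m i ≠ (a : ℝ) / b

/-- `D'` is equivalent to `D`, and `D' - j v - (n - j) w` is effective, where `v` and `w` are the
left and right ends of the chain. -/
def IsDistinguished (hg : 0 < g) (D : C.graph.Divisor) (n j : ℤ) (D' : C.graph.Divisor) : Prop :=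
  Equivalent D D' ∧
    0 ≤ D' - Finsupp.single (C.leftEnd hg) j - Finsupp.single (C.rightEnd hg) (n - j)

end ChainOfLoops

/-- The Brill-Noether number. -/
def brillNoetherNumber (g r : ℕ) (d : ℤ) : ℤ := g - (r + 1) * (g - d + r)

end

noncomputable section

/-! ### One-sided integer slopes -/

/-! On a chain of loops two divisors are equivalent exactly when they have the same degree and the
same Abel-Jacobi image `jac i` at every loop (`jac_eq_of_equivalent`, `equivalent_of_jac_eq`), so
divisor classes can be studied loop by loop. To an effective divisor equivalent to `D` minus some
chips one attaches a level, which gains one at each loop and loses the chips met or removed on the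
way (`isPath_of_effective`). It can rise only across an empty loop, and then `jac i D` is
prescribed: this is the condition `Climb D i z`. Genericity keeps the levels `z` satisfying it far
apart (`sparse_climb`).

An adversary who chooses which chips to remove can keep the level below a system of beads
(`exists_forcing`). If the rank is at least `r`, the `r + 1` beads must therefore rise by `t = g - d
+ r` levels each. Only one can climb at each of the `g = (r + 1) * t` loops, so exactly one does:
the beads trace a rectangular tableau (`isTableau_bead`). The level path of `D_j - j v - (r - j) w`
is then forced to follow bead `j` (`IsTableau.path_eq`), which locates every chip and gives
existence and uniqueness of `D_j`. The `t` holes among the levels from `-t` to `r` fall as the beads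
climb. Under the reflection `z ↦ -z - 2` of the climbing condition they form the tableau of `K - D`
(`IsTableau.dual`, `climb_residual`), so the same argument yields the `E_k`.

Up to a common summand, `φ_j + ψ_k` has divisor `D_j + E_k - K`, and its slope on the bridge before
a loop is the level of bead `j` minus that of hole `k`. Extended to the two ends, this number is
never zero, is negative at the left end and positive at the right end, and jumps from `-1` to `1` at
a given loop only for the pair exchanging places there. In `not_minTwice` one finds a loop which all
minimizers at its left vertex enter with negative slope and all minimizers at its right vertex leave
with positive slope. Concavity on the edges forces every minimizer at the vertex with the lower
minimum to jump from `-1` to `1`, so there is only one. This holds for all subfamilies, so no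
nontrivial linear relation between the products can have cancelling valuations
(`mulMap_injective_of_not_minTwice`). -/

theorem HasRightSlope.unique {u : ℝ → ℝ} {x : ℝ} {m n : ℤ} (hm : HasRightSlope u x m)
    (hn : HasRightSlope u x n) : m = n := by
  obtain ⟨y, ⟨h1, h2⟩, hy⟩ := ((hm.and hn).and self_mem_nhdsWithin).exists
  have hy' : (0 : ℝ) < y - x := sub_pos.2 hy
  have : ((m : ℝ) - n) * (y - x) = 0 := by linarith
  rcases mul_eq_zero.1 this with h | h
  · exact_mod_cast sub_eq_zero.1 h
  · exact absurd h hy'.ne'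

theorem HasLeftSlope.unique {u : ℝ → ℝ} {x : ℝ} {m n : ℤ} (hm : HasLeftSlope u x m)
    (hn : HasLeftSlope u x n) : m = n := by
  obtain ⟨y, ⟨h1, h2⟩, hy⟩ := ((hm.and hn).and self_mem_nhdsWithin).exists
  have hy' : y - x < 0 := sub_neg.2 hy
  have : ((m : ℝ) - n) * (y - x) = 0 := by linarith
  rcases mul_eq_zero.1 this with h | h
  · exact_mod_cast sub_eq_zero.1 h
  · exact absurd h hy'.ne

theorem HasRightSlope.rightSlope_eq {u : ℝ → ℝ} {x : ℝ} {n : ℤ} (h : HasRightSlope u x n) :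
    rightSlope u x = n := by
  have hex : ∃ n, HasRightSlope u x n := ⟨n, h⟩
  rw [rightSlope, dif_pos hex]
  exact hex.choose_spec.unique h

theorem HasLeftSlope.leftSlope_eq {u : ℝ → ℝ} {x : ℝ} {n : ℤ} (h : HasLeftSlope u x n) :
    leftSlope u x = n := by
  have hex : ∃ n, HasLeftSlope u x n := ⟨n, h⟩
  rw [leftSlope, dif_pos hex]
  exact hex.choose_spec.unique h

theorem HasRightSlope.add {u w : ℝ → ℝ} {x : ℝ} {m n : ℤ} (hu : HasRightSlope u x m)
    (hw : HasRightSlope w x n) : HasRightSlope (fun y => u y + w y) x (m + n) := by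
  filter_upwards [hu, hw] with y h1 h2
  rw [h1, h2]; push_cast; ring

theorem HasLeftSlope.add {u w : ℝ → ℝ} {x : ℝ} {m n : ℤ} (hu : HasLeftSlope u x m)
    (hw : HasLeftSlope w x n) : HasLeftSlope (fun y => u y + w y) x (m + n) := by
  filter_upwards [hu, hw] with y h1 h2
  rw [h1, h2]; push_cast; ring

theorem HasRightSlope.neg {u : ℝ → ℝ} {x : ℝ} {m : ℤ} (hu : HasRightSlope u x m) :
    HasRightSlope (fun y => -u y) x (-m) := by
  filter_upwards [hu] with y h1
  rw [h1]; push_cast; ring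

theorem HasLeftSlope.neg {u : ℝ → ℝ} {x : ℝ} {m : ℤ} (hu : HasLeftSlope u x m) :
    HasLeftSlope (fun y => -u y) x (-m) := by
  filter_upwards [hu] with y h1
  rw [h1]; push_cast; ring

theorem HasRightSlope.const_mul {u : ℝ → ℝ} {x : ℝ} {m : ℤ} (hu : HasRightSlope u x m) (a : ℤ) :
    HasRightSlope (fun y => a * u y) x (a * m) := by
  filter_upwards [hu] with y h1
  rw [h1]; push_cast; ring

theorem HasLeftSlope.const_mul {u : ℝ → ℝ} {x : ℝ} {m : ℤ} (hu : HasLeftSlope u x m) (a : ℤ) :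
    HasLeftSlope (fun y => a * u y) x (a * m) := by
  filter_upwards [hu] with y h1
  rw [h1]; push_cast; ring

theorem hasRightSlope_affine (c : ℝ) (s : ℤ) (x : ℝ) : HasRightSlope (fun y => c + s * y) x s :=
  Eventually.of_forall fun y => by ring

theorem hasLeftSlope_affine (c : ℝ) (s : ℤ) (x : ℝ) : HasLeftSlope (fun y => c + s * y) x s :=
  Eventually.of_forall fun y => by ring

theorem HasRightSlope.sum {ι : Type*} {s : Finset ι} {u : ι → ℝ → ℝ} {x : ℝ} {m : ι → ℤ}
    (h : ∀ i ∈ s, HasRightSlope (u i) x (m i)) :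
    HasRightSlope (fun y => ∑ i ∈ s, u i y) x (∑ i ∈ s, m i) := by
  have : ∀ᶠ y in 𝓝[>] x, ∀ i ∈ s, u i y = u i x + m i * (y - x) :=
    (Filter.eventually_all_finset s).2 h
  filter_upwards [this] with y hy
  rw [Finset.sum_congr rfl hy, Finset.sum_add_distrib, ← Finset.sum_mul]
  push_cast; rfl

theorem HasLeftSlope.sum {ι : Type*} {s : Finset ι} {u : ι → ℝ → ℝ} {x : ℝ} {m : ι → ℤ}
    (h : ∀ i ∈ s, HasLeftSlope (u i) x (m i)) :
    HasLeftSlope (fun y => ∑ i ∈ s, u i y) x (∑ i ∈ s, m i) := by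
  have : ∀ᶠ y in 𝓝[<] x, ∀ i ∈ s, u i y = u i x + m i * (y - x) :=
    (Filter.eventually_all_finset s).2 h
  filter_upwards [this] with y hy
  rw [Finset.sum_congr rfl hy, Finset.sum_add_distrib, ← Finset.sum_mul]
  push_cast; rfl

theorem HasRightSlope.congr {u w : ℝ → ℝ} {x L : ℝ} {n : ℤ} (h : HasRightSlope u x n)
    (hx : x < L) (huw : ∀ y, x ≤ y → y < L → w y = u y) : HasRightSlope w x n := by
  filter_upwards [h, Ioo_mem_nhdsGT hx] with y h1 h2
  rw [huw y h2.1.le h2.2, huw x le_rfl hx, h1]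

theorem HasLeftSlope.congr {u w : ℝ → ℝ} {x L : ℝ} {n : ℤ} (h : HasLeftSlope u x n)
    (hx : L < x) (huw : ∀ y, L < y → y ≤ x → w y = u y) : HasLeftSlope w x n := by
  filter_upwards [h, Ioo_mem_nhdsLT hx] with y h1 h2
  rw [huw y h2.1 h2.2.le, huw x hx le_rfl, h1]

theorem hasRightSlope_max_sub_zero (a x : ℝ) :
    HasRightSlope (fun y => max (y - a) 0) x (if a ≤ x then 1 else 0) := by
  split_ifs with h
  · filter_upwards [self_mem_nhdsWithin] with y hy
    have hy : x < y := hy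
    rw [max_eq_left (by linarith), max_eq_left (by linarith)]; push_cast; ring
  · push Not at h
    filter_upwards [Ioo_mem_nhdsGT h] with y hy
    rw [max_eq_right (by linarith [hy.2]), max_eq_right (by linarith)]; push_cast; ring

theorem hasLeftSlope_max_sub_zero (a x : ℝ) :
    HasLeftSlope (fun y => max (y - a) 0) x (if a < x then 1 else 0) := by
  split_ifs with h
  · filter_upwards [Ioo_mem_nhdsLT h] with y hy
    rw [max_eq_left (by linarith [hy.1]), max_eq_left (by linarith)]; push_cast; ring
  · push Not at h
    filter_upwards [self_mem_nhdsWithin] with y hy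
    have hy : y < x := hy
    rw [max_eq_right (by linarith), max_eq_right (by linarith)]; push_cast; ring

theorem HasRightSlope.continuousWithinAt {u : ℝ → ℝ} {x : ℝ} {n : ℤ} (h : HasRightSlope u x n) :
    ContinuousWithinAt u (Set.Ioi x) x := by
  have : ContinuousWithinAt (fun y => u x + n * (y - x)) (Set.Ioi x) x := by fun_prop
  exact this.congr_of_eventuallyEq h (by simp)

theorem HasLeftSlope.continuousWithinAt {u : ℝ → ℝ} {x : ℝ} {n : ℤ} (h : HasLeftSlope u x n) :
    ContinuousWithinAt u (Set.Iio x) x := by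
  have : ContinuousWithinAt (fun y => u x + n * (y - x)) (Set.Iio x) x := by fun_prop
  exact this.congr_of_eventuallyEq h (by simp)

/-- A function which bends nowhere and starts horizontally is constant. -/
theorem eq_of_slopes_agree {h : ℝ → ℝ} {L : ℝ}
    (h0 : HasRightSlope h 0 0)
    (hin : ∀ x, 0 < x → x < L → ∃ n, HasLeftSlope h x n ∧ HasRightSlope h x n)
    (hL : ∃ n, HasLeftSlope h L n) : ∀ y ∈ Set.Icc 0 L, h y = h 0 := by
  -- One-sided linearity gives one-sided continuity at each point; the two sides are glued so that
  -- the set where `h = h 0` is closed.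
  have hcont : ContinuousOn h (Set.Icc 0 L) := by
    intro x hx
    have hl : 0 < x → ContinuousWithinAt h (Set.Iio x) x := by
      intro hx0
      rcases hx.2.lt_or_eq with hxL | rfl
      · obtain ⟨n, hn, -⟩ := hin x hx0 hxL
        exact hn.continuousWithinAt
      · obtain ⟨n, hn⟩ := hL
        exact hn.continuousWithinAt
    have hr : x < L → ContinuousWithinAt h (Set.Ioi x) x := by
      intro hxL
      rcases hx.1.lt_or_eq with hx0 | rfl
      · obtain ⟨n, -, hn⟩ := hin x hx0 hxL
        exact hn.continuousWithinAt
      · exact h0.continuousWithinAt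
    have hl' : ContinuousWithinAt h (Set.Icc 0 x) x := by
      rcases hx.1.lt_or_eq with hx0 | rfl
      · exact (continuousWithinAt_Iio_iff_Iic.1 (hl hx0)).mono Set.Icc_subset_Iic_self
      · simp [continuousWithinAt_singleton]
    have hr' : ContinuousWithinAt h (Set.Icc x L) x := by
      rcases hx.2.lt_or_eq with hxL | rfl
      · exact (continuousWithinAt_Ioi_iff_Ici.1 (hr hxL)).mono Set.Icc_subset_Ici_self
      · simp [continuousWithinAt_singleton]
    have := hl'.union hr'
    rwa [Set.Icc_union_Icc_eq_Icc hx.1 hx.2] at this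
  have hclosed : IsClosed ({y | h y = h 0} ∩ Set.Icc 0 L) := by
    have := hcont.preimage_isClosed_of_isClosed isClosed_Icc (isClosed_singleton (x := h 0))
    rwa [Set.inter_comm] at this
  -- Continuous induction: where `h` has been constant so far, its left slope is zero, hence so is
  -- its right slope, and constancy extends a little further.
  have key := hclosed.Icc_subset_of_forall_mem_nhdsGT_of_Icc_subset (by simp) (by
    intro x hx hsub
    have hsl : HasRightSlope h x 0 := by
      rcases hx.1.lt_or_eq with hx0 | rfl
      · obtain ⟨n, hn, hn'⟩ := hin x hx0 hx.2
        have : HasLeftSlope h x 0 := by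
          filter_upwards [Ioo_mem_nhdsLT hx0] with y hy
          have e1 : h y = h 0 := hsub ⟨hy.1.le, hy.2.le⟩
          have e2 : h x = h 0 := hsub ⟨hx0.le, le_rfl⟩
          rw [e1, e2]; simp
        rwa [hn.unique this] at hn'
      · exact h0
    have e2 : h x = h 0 := hsub ⟨hx.1, le_rfl⟩
    filter_upwards [hsl] with y hy
    show h y = h 0
    rw [hy, e2]; simp)
  exact fun y hy => key hy

namespace MetricGraph

variable {G : MetricGraph}

theorem pt_of_nonpos (e : G.E) {x : ℝ} (h : x ≤ 0) : G.pt e x = Point.vertex (G.src e) := by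
  rw [pt, dif_neg (not_lt.2 h)]

theorem pt_of_le (e : G.E) {x : ℝ} (h : G.len e ≤ x) : G.pt e x = Point.vertex (G.tgt e) := by
  rw [pt, dif_pos ((G.len_pos e).trans_le h), dif_neg (not_lt.2 h)]

theorem pt_zero (e : G.E) : G.pt e 0 = Point.vertex (G.src e) := pt_of_nonpos e le_rfl

theorem pt_len (e : G.E) : G.pt e (G.len e) = Point.vertex (G.tgt e) := pt_of_le e le_rfl

theorem pt_of_mem (e : G.E) {x : ℝ} (h0 : 0 < x) (h1 : x < G.len e) :
    G.pt e x = Point.interior e x h0 h1 := by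
  rw [pt, dif_pos h0, dif_pos h1]

/-! ### Piecewise linear functions on a metric graph -/

/-- The slope of a piecewise linear function at the beginning of an edge. -/
def startSlope (f : G.Point → ℝ) (e : G.E) : ℤ := rightSlope (fun y => f (G.pt e y)) 0

/-- The slope of a piecewise linear function at the end of an edge. -/
def endSlope (f : G.Point → ℝ) (e : G.E) : ℤ := leftSlope (fun y => f (G.pt e y)) (G.len e)

theorem IsPL.hasRightSlope {f : G.Point → ℝ} (hf : G.IsPL f) (e : G.E) {x : ℝ} (h0 : 0 ≤ x)
    (h1 : x < G.len e) :
    HasRightSlope (fun y => f (G.pt e y)) x (rightSlope (fun y => f (G.pt e y)) x) := by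
  obtain ⟨n, hn⟩ := (hf e).1 x h0 h1
  rwa [hn.rightSlope_eq]

theorem IsPL.hasLeftSlope {f : G.Point → ℝ} (hf : G.IsPL f) (e : G.E) {x : ℝ} (h0 : 0 < x)
    (h1 : x ≤ G.len e) :
    HasLeftSlope (fun y => f (G.pt e y)) x (leftSlope (fun y => f (G.pt e y)) x) := by
  obtain ⟨n, hn⟩ := (hf e).2 x h0 h1
  rwa [hn.leftSlope_eq]

theorem IsPL.add {f h : G.Point → ℝ} (hf : G.IsPL f) (hh : G.IsPL h) : G.IsPL (f + h) :=
  fun e => ⟨fun _ h0 h1 => ⟨_, (hf.hasRightSlope e h0 h1).add (hh.hasRightSlope e h0 h1)⟩,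
    fun _ h0 h1 => ⟨_, (hf.hasLeftSlope e h0 h1).add (hh.hasLeftSlope e h0 h1)⟩⟩

theorem IsPL.neg {f : G.Point → ℝ} (hf : G.IsPL f) : G.IsPL (-f) :=
  fun e => ⟨fun _ h0 h1 => ⟨_, (hf.hasRightSlope e h0 h1).neg⟩,
    fun _ h0 h1 => ⟨_, (hf.hasLeftSlope e h0 h1).neg⟩⟩

theorem IsPL.rightSlope_add {f h : G.Point → ℝ} (hf : G.IsPL f) (hh : G.IsPL h) (e : G.E) {x : ℝ}
    (h0 : 0 ≤ x) (h1 : x < G.len e) :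
    rightSlope (fun y => (f + h) (G.pt e y)) x =
      rightSlope (fun y => f (G.pt e y)) x + rightSlope (fun y => h (G.pt e y)) x :=
  ((hf.hasRightSlope e h0 h1).add (hh.hasRightSlope e h0 h1)).rightSlope_eq

theorem IsPL.leftSlope_add {f h : G.Point → ℝ} (hf : G.IsPL f) (hh : G.IsPL h) (e : G.E) {x : ℝ}
    (h0 : 0 < x) (h1 : x ≤ G.len e) :
    leftSlope (fun y => (f + h) (G.pt e y)) x =
      leftSlope (fun y => f (G.pt e y)) x + leftSlope (fun y => h (G.pt e y)) x :=
  ((hf.hasLeftSlope e h0 h1).add (hh.hasLeftSlope e h0 h1)).leftSlope_eq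

theorem IsPL.rightSlope_neg {f : G.Point → ℝ} (hf : G.IsPL f) (e : G.E) {x : ℝ}
    (h0 : 0 ≤ x) (h1 : x < G.len e) :
    rightSlope (fun y => (-f) (G.pt e y)) x = -rightSlope (fun y => f (G.pt e y)) x :=
  (hf.hasRightSlope e h0 h1).neg.rightSlope_eq

theorem IsPL.leftSlope_neg {f : G.Point → ℝ} (hf : G.IsPL f) (e : G.E) {x : ℝ}
    (h0 : 0 < x) (h1 : x ≤ G.len e) :
    leftSlope (fun y => (-f) (G.pt e y)) x = -leftSlope (fun y => f (G.pt e y)) x :=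
  (hf.hasLeftSlope e h0 h1).neg.leftSlope_eq

theorem IsPL.ord_add {f h : G.Point → ℝ} (hf : G.IsPL f) (hh : G.IsPL h) (p : G.Point) :
    G.ord (f + h) p = G.ord f p + G.ord h p := by
  classical
  cases p with
  | vertex v =>
    simp only [ord, hf.rightSlope_add hh _ le_rfl (G.len_pos _),
      hf.leftSlope_add hh _ (G.len_pos _) le_rfl]
    simp only [← Finset.sum_add_distrib]
    refine Finset.sum_congr rfl fun e _ => ?_
    split_ifs <;> ring
  | interior e x h0 h1 =>
    simp only [ord, hf.rightSlope_add hh e h0.le h1, hf.leftSlope_add hh e h0 h1.le]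
    ring

theorem IsPL.ord_neg {f : G.Point → ℝ} (hf : G.IsPL f) (p : G.Point) :
    G.ord (-f) p = -G.ord f p := by
  classical
  cases p with
  | vertex v =>
    simp only [ord, hf.rightSlope_neg _ le_rfl (G.len_pos _),
      hf.leftSlope_neg _ (G.len_pos _) le_rfl]
    simp only [← Finset.sum_add_distrib, ← Finset.sum_neg_distrib]
    refine Finset.sum_congr rfl fun e _ => ?_
    split_ifs <;> ring
  | interior e x h0 h1 =>
    simp only [ord, hf.rightSlope_neg e h0.le h1, hf.leftSlope_neg e h0 h1.le]
    ring

theorem Moves.add {f h : G.Point → ℝ} {D D' E E' : G.Divisor} (hf : Moves f D D')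
    (hh : Moves h E E') : Moves (f + h) (D + E) (D' + E') :=
  ⟨hf.1.add hh.1, fun p => by
    rw [hf.1.ord_add hh.1, Finsupp.add_apply, Finsupp.add_apply, ← hf.2, ← hh.2]; ring⟩

theorem Moves.symm {f : G.Point → ℝ} {D D' : G.Divisor} (hf : Moves f D D') : Moves (-f) D' D :=
  ⟨hf.1.neg, fun p => by rw [hf.1.ord_neg, ← hf.2]; ring⟩

theorem Moves.trans {f h : G.Point → ℝ} {D D' D'' : G.Divisor} (hf : Moves f D D')
    (hh : Moves h D' D'') : Moves (f + h) D D'' :=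
  ⟨hf.1.add hh.1, fun p => by rw [hf.1.ord_add hh.1, ← hh.2, ← hf.2]; ring⟩

/-! ### The function on an edge with prescribed kinks -/

open Classical in
/-- The kink function of a point on the edge `e`. -/
def kink (e : G.E) (y : ℝ) : G.Point → ℝ
  | .vertex _ => 0
  | .interior e' x _ _ => if e' = e then max (y - x) 0 else 0

open Classical in
/-- The indicator of the interior points of the edge `e` at distance less than `y`. -/
def before (e : G.E) (y : ℝ) : G.Point → ℤ
  | .vertex _ => 0
  | .interior e' x _ _ => if e' = e ∧ x < y then 1 else 0

open Classical in
/-- The indicator of the interior points of the edge `e` at distance at most `y`. -/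
def upTo (e : G.E) (y : ℝ) : G.Point → ℤ
  | .vertex _ => 0
  | .interior e' x _ _ => if e' = e ∧ x ≤ y then 1 else 0

/-- The sum of the kink functions of the points of `Z` on the edge `e`. -/
def kinkSum (Z : G.Divisor) (e : G.E) (y : ℝ) : ℝ := ∑ p ∈ Z.support, Z p * kink e y p

theorem kinkSum_zero (Z : G.Divisor) (e : G.E) : kinkSum Z e 0 = 0 := by
  refine Finset.sum_eq_zero fun p _ => ?_
  cases p with
  | vertex v => simp [kink]
  | interior e' x h0 h1 => simp [kink, h0.le]

theorem hasRightSlope_kinkSum (Z : G.Divisor) (e : G.E) (x : ℝ) :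
    HasRightSlope (kinkSum Z e) x (∑ p ∈ Z.support, Z p * upTo e x p) := by
  refine HasRightSlope.sum fun p _ => HasRightSlope.const_mul ?_ _
  cases p with
  | vertex v => exact Eventually.of_forall fun y => by simp [kink, upTo]
  | interior e' x' h0 h1 =>
    by_cases he : e' = e
    · simpa [kink, upTo, he] using hasRightSlope_max_sub_zero x' x
    · exact Eventually.of_forall fun y => by simp [kink, upTo, he]

theorem hasLeftSlope_kinkSum (Z : G.Divisor) (e : G.E) (x : ℝ) :
    HasLeftSlope (kinkSum Z e) x (∑ p ∈ Z.support, Z p * before e x p) := by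
  refine HasLeftSlope.sum fun p _ => HasLeftSlope.const_mul ?_ _
  cases p with
  | vertex v => exact Eventually.of_forall fun y => by simp [kink, before]
  | interior e' x' h0 h1 =>
    by_cases he : e' = e
    · simpa [kink, before, he] using hasLeftSlope_max_sub_zero x' x
    · exact Eventually.of_forall fun y => by simp [kink, before, he]

theorem upTo_zero (Z : G.Divisor) (e : G.E) : ∑ p ∈ Z.support, Z p * upTo e 0 p = 0 := by
  refine Finset.sum_eq_zero fun p _ => ?_
  cases p with
  | vertex v => simp [upTo]
  | interior e' x h0 h1 => simp [upTo, h0]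

/-- The two one-sided slopes of `kinkSum` at an interior point differ by the multiplicity of `Z`
there, just as those of a function of order `Z` do, with the opposite sign. -/
theorem upTo_eq_before_add (Z : G.Divisor) (e : G.E) {x : ℝ} (h0 : 0 < x) (h1 : x < G.len e) :
    ∑ p ∈ Z.support, Z p * upTo e x p =
      (∑ p ∈ Z.support, Z p * before e x p) + Z (Point.interior e x h0 h1) := by
  classical
  have : Z (Point.interior e x h0 h1) =
      ∑ p ∈ Z.support, Z p * if p = Point.interior e x h0 h1 then 1 else 0 := by
    simp
  rw [this, ← Finset.sum_add_distrib]
  refine Finset.sum_congr rfl fun p _ => ?_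
  rw [← mul_add]
  congr 1
  cases p with
  | vertex v => simp [upTo, before]
  | interior e' x' h0 h1 =>
    simp only [upTo, before, Point.interior.injEq]
    by_cases he : e' = e
    · rcases lt_trichotomy x' x with h | h | h
      · simp [he, h, h.le, h.ne]
      · simp [he, h]
      · simp [he, h.not_gt, h.not_ge, h.ne']
    · simp [he]

/-- Past a point `p` the slope of `f` drops by `Z p`. Adding `kinkSum` and subtracting the initial
linear function leaves something that bends nowhere and starts horizontally, so `eq_of_slopes_agree`
applies. -/
theorem IsPL.apply_pt {f : G.Point → ℝ} (hf : G.IsPL f) {Z : G.Divisor} (hZ : ∀ p, G.ord f p = Z p)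
    (e : G.E) {y : ℝ} (hy : y ∈ Set.Icc 0 (G.len e)) :
    f (G.pt e y) = f (Point.vertex (G.src e)) + startSlope f e * y - kinkSum Z e y := by
  set u : ℝ → ℝ := fun y => f (G.pt e y) with hu
  have hR : ∀ x, 0 ≤ x → x < G.len e → HasRightSlope
      (fun y => u y + (kinkSum Z e y + -(f (Point.vertex (G.src e)) + startSlope f e * y))) x
      (rightSlope u x + ((∑ p ∈ Z.support, Z p * upTo e x p) + -startSlope f e)) :=
    fun x h0 h1 => (hf.hasRightSlope e h0 h1).add
      ((hasRightSlope_kinkSum Z e x).add (hasRightSlope_affine _ _ _).neg)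
  have hL : ∀ x, 0 < x → x ≤ G.len e → HasLeftSlope
      (fun y => u y + (kinkSum Z e y + -(f (Point.vertex (G.src e)) + startSlope f e * y))) x
      (leftSlope u x + ((∑ p ∈ Z.support, Z p * before e x p) + -startSlope f e)) :=
    fun x h0 h1 => (hf.hasLeftSlope e h0 h1).add
      ((hasLeftSlope_kinkSum Z e x).add (hasLeftSlope_affine _ _ _).neg)
  have := eq_of_slopes_agree (L := G.len e) (h := fun y => u y + (kinkSum Z e y +
      -(f (Point.vertex (G.src e)) + startSlope f e * y))) (by
      have := hR 0 le_rfl (G.len_pos e)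
      rwa [upTo_zero, zero_add, startSlope, ← hu, add_neg_cancel] at this)
    (fun x h0 h1 => ⟨_, hL x h0 h1.le, by
      have h2 := hR x h0.le h1
      have h3 := hZ (Point.interior e x h0 h1)
      rw [ord, ← hu] at h3
      rw [upTo_eq_before_add Z e h0 h1, ← h3] at h2
      convert h2 using 1
      ring⟩) ⟨_, hL _ (G.len_pos e) le_rfl⟩ y hy
  simp only [hu, pt_zero, kinkSum_zero] at this
  linarith

theorem IsPL.apply_tgt {f : G.Point → ℝ} (hf : G.IsPL f) {Z : G.Divisor}
    (hZ : ∀ p, G.ord f p = Z p) (e : G.E) :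
    f (Point.vertex (G.tgt e)) =
      f (Point.vertex (G.src e)) + startSlope f e * G.len e - kinkSum Z e (G.len e) := by
  rw [← pt_len, hf.apply_pt hZ e ⟨(G.len_pos e).le, le_rfl⟩]

/-- The degree of a divisor on the interior of an edge. -/
def edgeDegree (e : G.E) (Z : G.Divisor) : ℤ := ∑ p ∈ Z.support, Z p * before e (G.len e) p

theorem IsPL.endSlope_eq {f : G.Point → ℝ} (hf : G.IsPL f) {Z : G.Divisor}
    (hZ : ∀ p, G.ord f p = Z p) (e : G.E) :
    endSlope f e = startSlope f e - edgeDegree e Z := by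
  have h := ((hasLeftSlope_affine (f (Point.vertex (G.src e))) (startSlope f e) (G.len e)).add
    (hasLeftSlope_kinkSum Z e (G.len e)).neg).congr (w := fun y => f (G.pt e y)) (G.len_pos e)
    (fun y h0 h1 => by
      rw [hf.apply_pt hZ e ⟨h0.le, h1⟩]; ring)
  rw [endSlope, h.leftSlope_eq, edgeDegree]; ring

open Classical in
theorem ord_vertex (f : G.Point → ℝ) (v : G.V) :
    G.ord f (Point.vertex v) = (∑ e : G.E, if G.src e = v then -startSlope f e else 0) +
      ∑ e : G.E, if G.tgt e = v then endSlope f e else 0 := rfl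

/-- The function with given values at the vertices, given initial slopes on the edges and given
kinks. -/
def ofKinks (Z : G.Divisor) (c : G.V → ℝ) (s : G.E → ℤ) : G.Point → ℝ
  | .vertex v => c v
  | .interior e x _ _ => c (G.src e) + s e * x - kinkSum Z e x

/-! ### Functions built from vertex values, initial slopes and kinks -/

section ofKinks

variable {Z : G.Divisor} {c : G.V → ℝ} {s : G.E → ℤ}

/-- The hypothesis `hc` is the compatibility condition: the formula along each edge must arrive at
the value prescribed at its target. -/
theorem ofKinks_pt
    (hc : ∀ e, c (G.tgt e) = c (G.src e) + s e * G.len e - kinkSum Z e (G.len e))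
    (e : G.E) {y : ℝ} (h0 : 0 ≤ y) (h1 : y ≤ G.len e) :
    ofKinks Z c s (G.pt e y) = c (G.src e) + s e * y - kinkSum Z e y := by
  rcases h0.lt_or_eq with h0 | rfl
  · rcases h1.lt_or_eq with h1 | rfl
    · rw [pt_of_mem e h0 h1]; rfl
    · rw [pt_len]; exact hc e
  · rw [pt_zero, kinkSum_zero]; simp [ofKinks]

theorem hasRightSlope_ofKinks
    (hc : ∀ e, c (G.tgt e) = c (G.src e) + s e * G.len e - kinkSum Z e (G.len e))
    (e : G.E) {x : ℝ} (h0 : 0 ≤ x) (h1 : x < G.len e) :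
    HasRightSlope (fun y => ofKinks Z c s (G.pt e y)) x
      (s e + -∑ p ∈ Z.support, Z p * upTo e x p) :=
  ((hasRightSlope_affine (c (G.src e)) (s e) x).add (hasRightSlope_kinkSum Z e x).neg).congr h1
    (fun y hy hy' => by rw [ofKinks_pt hc e (h0.trans hy) hy'.le]; ring)

theorem hasLeftSlope_ofKinks
    (hc : ∀ e, c (G.tgt e) = c (G.src e) + s e * G.len e - kinkSum Z e (G.len e))
    (e : G.E) {x : ℝ} (h0 : 0 < x) (h1 : x ≤ G.len e) :
    HasLeftSlope (fun y => ofKinks Z c s (G.pt e y)) x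
      (s e + -∑ p ∈ Z.support, Z p * before e x p) :=
  ((hasLeftSlope_affine (c (G.src e)) (s e) x).add (hasLeftSlope_kinkSum Z e x).neg).congr h0
    (fun y hy hy' => by rw [ofKinks_pt hc e hy.le (hy'.trans h1)]; ring)

theorem isPL_ofKinks
    (hc : ∀ e, c (G.tgt e) = c (G.src e) + s e * G.len e - kinkSum Z e (G.len e)) :
    G.IsPL (ofKinks Z c s) :=
  fun e => ⟨fun _ h0 h1 => ⟨_, hasRightSlope_ofKinks hc e h0 h1⟩,
    fun _ h0 h1 => ⟨_, hasLeftSlope_ofKinks hc e h0 h1⟩⟩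

theorem startSlope_ofKinks
    (hc : ∀ e, c (G.tgt e) = c (G.src e) + s e * G.len e - kinkSum Z e (G.len e))
    (e : G.E) : startSlope (ofKinks Z c s) e = s e := by
  rw [startSlope, (hasRightSlope_ofKinks hc e le_rfl (G.len_pos e)).rightSlope_eq, upTo_zero]
  simp

theorem endSlope_ofKinks
    (hc : ∀ e, c (G.tgt e) = c (G.src e) + s e * G.len e - kinkSum Z e (G.len e))
    (e : G.E) :
    endSlope (ofKinks Z c s) e = s e - edgeDegree e Z := by
  rw [endSlope, (hasLeftSlope_ofKinks hc e (G.len_pos e) le_rfl).leftSlope_eq, edgeDegree,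
    sub_eq_add_neg]

theorem ord_ofKinks_interior
    (hc : ∀ e, c (G.tgt e) = c (G.src e) + s e * G.len e - kinkSum Z e (G.len e))
    (e : G.E) {x : ℝ} (h0 : 0 < x) (h1 : x < G.len e) :
    G.ord (ofKinks Z c s) (Point.interior e x h0 h1) = Z (Point.interior e x h0 h1) := by
  rw [ord, (hasRightSlope_ofKinks hc e h0.le h1).rightSlope_eq,
    (hasLeftSlope_ofKinks hc e h0 h1.le).leftSlope_eq, upTo_eq_before_add Z e h0 h1]
  ring

end ofKinks

end MetricGraph

namespace MetricGraph

variable {G : MetricGraph}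

/-! ### Weighted degrees of divisors -/

/-- The weighted degree of a divisor. -/
def weigh {M : Type*} [AddCommGroup M] (c : G.Point → M) : G.Divisor →+ M :=
  Finsupp.liftAddHom fun p => zmultiplesHom M (c p)

@[simp] theorem weigh_single {M : Type*} [AddCommGroup M] (c : G.Point → M) (p : G.Point) (a : ℤ) :
    weigh c (Finsupp.single p a) = a • c p := by
  simp [weigh]

theorem weigh_apply {M : Type*} [AddCommGroup M] (c : G.Point → M) (Z : G.Divisor) :
    weigh c Z = ∑ p ∈ Z.support, Z p • c p := by
  simp [weigh, Finsupp.sum]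

theorem kinkSum_eq_weigh (Z : G.Divisor) (e : G.E) (y : ℝ) :
    kinkSum Z e y = weigh (kink e y) Z := by
  simp [kinkSum, weigh_apply]

theorem edgeDegree_eq_weigh (Z : G.Divisor) (e : G.E) :
    edgeDegree e Z = weigh (before e (G.len e)) Z := by
  simp [edgeDegree, weigh_apply]

theorem degree_eq_weigh (Z : G.Divisor) : degree Z = weigh (fun _ => (1 : ℤ)) Z := by
  simp [degree, weigh_apply, Finsupp.sum]

theorem weigh_nonneg {c : G.Point → ℤ} {Z : G.Divisor} (hc : ∀ p, 0 ≤ c p)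
    (hZ : ∀ p, c p ≠ 0 → 0 ≤ Z p) : 0 ≤ weigh c Z := by
  rw [weigh_apply]
  refine Finset.sum_nonneg fun p _ => ?_
  by_cases h : c p = 0
  · simp [h]
  · exact mul_nonneg (hZ p h) (hc p)

theorem weigh_congr {M : Type*} [AddCommGroup M] {c c' : G.Point → M} {Z : G.Divisor}
    (h : ∀ p, Z p ≠ 0 → c p = c' p) : weigh c Z = weigh c' Z := by
  rw [weigh_apply, weigh_apply]
  exact Finset.sum_congr rfl fun p hp => by rw [h p (Finsupp.mem_support_iff.1 hp)]

theorem kinkSum_nonneg {Z : G.Divisor} {e : G.E} {y : ℝ}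
    (hZ : ∀ x h0 h1, 0 ≤ Z (Point.interior e x h0 h1)) : 0 ≤ kinkSum Z e y := by
  refine Finset.sum_nonneg fun p _ => ?_
  cases p with
  | vertex v => simp [kink]
  | interior e' x h0 h1 =>
    by_cases h : e' = e
    · subst h
      have := hZ x h0 h1
      simp only [kink, if_true]
      have : (0 : ℝ) ≤ Z (Point.interior e' x h0 h1) := by exact_mod_cast this
      positivity
    · simp [kink, h]

/-- Every interior point lies at positive distance from the end of the edge, so with nonnegative
multiplicities the sum of the kinks vanishes there only if the edge carries no chips. -/
theorem edgeDegree_eq_zero {Z : G.Divisor} {e : G.E}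
    (hZ : ∀ x h0 h1, 0 ≤ Z (Point.interior e x h0 h1)) (h : kinkSum Z e (G.len e) = 0) :
    edgeDegree e Z = 0 := by
  have hnn : ∀ p ∈ Z.support, 0 ≤ (Z p : ℝ) * kink e (G.len e) p := by
    intro p _
    cases p with
    | vertex v => simp [kink]
    | interior e' x h0 h1 =>
      by_cases h : e' = e
      · subst h
        have := hZ x h0 h1
        simp only [kink, if_true]
        have : (0 : ℝ) ≤ Z (Point.interior e' x h0 h1) := by exact_mod_cast this
        positivity
      · simp [kink, h]
  refine Finset.sum_eq_zero fun p hp => ?_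
  have h1 := (Finset.sum_eq_zero_iff_of_nonneg hnn).1 h p hp
  cases p with
  | vertex v => simp [before]
  | interior e' x h0 h1 =>
    by_cases he : e' = e
    · subst he
      simp only [kink, if_true] at h1
      rw [max_eq_left (by linarith)] at h1
      rcases mul_eq_zero.1 h1 with h2 | h2
      · rw [Int.cast_eq_zero.1 h2, zero_mul]
      · linarith
    · simp [before, he]

end MetricGraph

namespace ChainOfLoops

open MetricGraph

variable {g : ℕ} (C : ChainOfLoops g)

/-! ### Points, edges and slopes on a chain of loops -/

/-- The left vertex of the `i`th loop, as a vertex of the graph. -/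
def idL (i : Fin g) : C.graph.V := (Sum.inl i : Fin g ⊕ Fin g)

/-- The right vertex of the `i`th loop, as a vertex of the graph. -/
def idR (i : Fin g) : C.graph.V := (Sum.inr i : Fin g ⊕ Fin g)

/-- The left vertex of the `i`th loop. -/
def vtxL (i : Fin g) : C.graph.Point := Point.vertex (C.idL i)

/-- The right vertex of the `i`th loop. -/
def vtxR (i : Fin g) : C.graph.Point := Point.vertex (C.idR i)

/-- The edge of length `ell i` of the `i`th loop. -/
def top (i : Fin g) : C.graph.E := (Sum.inl i : Fin g ⊕ Fin g ⊕ Fin (g - 1))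

/-- The edge of length `m i` of the `i`th loop. -/
def bot (i : Fin g) : C.graph.E := (Sum.inr (Sum.inl i) : Fin g ⊕ Fin g ⊕ Fin (g - 1))

/-- The `i`th bridge. -/
def bri (i : Fin (g - 1)) : C.graph.E := (Sum.inr (Sum.inr i) : Fin g ⊕ Fin g ⊕ Fin (g - 1))

variable {C} in
/-- Case distinction on the points of a chain of loops. -/
theorem point_cases {P : C.graph.Point → Prop} (hL : ∀ i, P (C.vtxL i)) (hR : ∀ i, P (C.vtxR i))
    (ht : ∀ i x h0 h1, P (Point.interior (C.top i) x h0 h1))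
    (hb : ∀ i x h0 h1, P (Point.interior (C.bot i) x h0 h1))
    (hbr : ∀ i x h0 h1, P (Point.interior (C.bri i) x h0 h1)) (p : C.graph.Point) : P p := by
  rcases p with (i | i) | ⟨(i | i | i), x, h0, h1⟩
  · exact hL i
  · exact hR i
  · exact ht i x h0 h1
  · exact hb i x h0 h1
  · exact hbr i x h0 h1

theorem top_injective : Function.Injective C.top := fun _ _ h => Sum.inl_injective h
theorem bot_injective : Function.Injective C.bot :=
  fun _ _ h => Sum.inl_injective (Sum.inr_injective h)
theorem bri_injective : Function.Injective C.bri :=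
  fun _ _ h => Sum.inr_injective (Sum.inr_injective h)

@[simp] theorem top_inj {i j : Fin g} : C.top i = C.top j ↔ i = j := C.top_injective.eq_iff
@[simp] theorem bot_inj {i j : Fin g} : C.bot i = C.bot j ↔ i = j := C.bot_injective.eq_iff
@[simp] theorem bri_inj {i j : Fin (g - 1)} : C.bri i = C.bri j ↔ i = j := C.bri_injective.eq_iff
@[simp] theorem top_ne_bot (i j : Fin g) : C.top i ≠ C.bot j := nofun
@[simp] theorem bot_ne_top (i j : Fin g) : C.bot i ≠ C.top j := nofun
@[simp] theorem top_ne_bri (i : Fin g) (j) : C.top i ≠ C.bri j := nofun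
@[simp] theorem bri_ne_top (j) (i : Fin g) : C.bri j ≠ C.top i := nofun
@[simp] theorem bot_ne_bri (i : Fin g) (j) : C.bot i ≠ C.bri j := nofun
@[simp] theorem bri_ne_bot (j) (i : Fin g) : C.bri j ≠ C.bot i := nofun

@[simp] theorem len_top (i : Fin g) : C.graph.len (C.top i) = C.ell i := rfl
@[simp] theorem len_bot (i : Fin g) : C.graph.len (C.bot i) = C.m i := rfl

/-- Position along the chain: the `i`th loop is at `2 * i`, the `i`th bridge at `2 * i + 1`. -/
def pos : C.graph.Point → ℕ
  | .vertex v => 2 * (Sum.elim (fun i => i.1) (fun i => i.1) : Fin g ⊕ Fin g → ℕ) v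
  | .interior e _ _ _ => (Sum.elim (fun i => 2 * i.1) (Sum.elim (fun i => 2 * i.1)
      (fun i => 2 * i.1 + 1)) : Fin g ⊕ Fin g ⊕ Fin (g - 1) → ℕ) e

@[simp] theorem pos_vtxL (i : Fin g) : C.pos (C.vtxL i) = 2 * i := rfl
@[simp] theorem pos_vtxR (i : Fin g) : C.pos (C.vtxR i) = 2 * i := rfl
@[simp] theorem pos_top (i : Fin g) (x h0 h1) :
    C.pos (Point.interior (C.top i) x h0 h1) = 2 * i := rfl
@[simp] theorem pos_bot (i : Fin g) (x h0 h1) :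
    C.pos (Point.interior (C.bot i) x h0 h1) = 2 * i := rfl
@[simp] theorem pos_bri (i : Fin (g - 1)) (x h0 h1) :
    C.pos (Point.interior (C.bri i) x h0 h1) = 2 * i + 1 := rfl

theorem pos_lt (p : C.graph.Point) : C.pos p + 1 < 2 * g := by
  induction p using point_cases with
  | hL i => have := i.2; simp; omega
  | hR i => have := i.2; simp; omega
  | ht i => have := i.2; simp; omega
  | hb i => have := i.2; simp; omega
  | hbr i => have := i.2; simp; omega

/-- The degree of a divisor on the part of the chain at positions less than `c`. -/
def degBefore (c : ℕ) : C.graph.Divisor →+ ℤ := weigh fun p => if C.pos p < c then 1 else 0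

@[simp] theorem degBefore_single (c : ℕ) (p : C.graph.Point) (a : ℤ) :
    C.degBefore c (Finsupp.single p a) = if C.pos p < c then a else 0 := by
  simp [degBefore]

@[simp] theorem degBefore_zero (Z : C.graph.Divisor) : C.degBefore 0 Z = 0 := by
  simp [degBefore, weigh_apply]

theorem degBefore_eq_degree {c : ℕ} (hc : 2 * g ≤ c + 1) (Z : C.graph.Divisor) :
    C.degBefore c Z = degree Z := by
  rw [degree_eq_weigh, degBefore]
  refine weigh_congr fun p _ => if_pos ?_
  have := C.pos_lt p
  omega

/-- The coordinate of a point on the `i`th loop, `vtxR i` being the origin, after retracting the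
chain to this loop. -/
def coord (i : Fin g) : C.graph.Point → ℝ
  | .vertex v => (Sum.elim (fun l => if l ≤ i then -C.ell i else 0)
      (fun l => if l < i then -C.ell i else 0) : Fin g ⊕ Fin g → ℝ) v
  | .interior e x _ _ => (Sum.elim
      (fun l => if l < i then -C.ell i else if l = i then x - C.ell i else 0)
      (Sum.elim (fun l => if l < i then -C.ell i else if l = i then -x - C.ell i else 0)
      (fun l => if l.1 < i.1 then -C.ell i else 0)) : Fin g ⊕ Fin g ⊕ Fin (g - 1) → ℝ) e

@[simp] theorem coord_vtxL (i l : Fin g) :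
    C.coord i (C.vtxL l) = if l ≤ i then -C.ell i else 0 := rfl
@[simp] theorem coord_vtxR (i l : Fin g) :
    C.coord i (C.vtxR l) = if l < i then -C.ell i else 0 := rfl
@[simp] theorem coord_top (i l : Fin g) (x h0 h1) :
    C.coord i (Point.interior (C.top l) x h0 h1) =
      if l < i then -C.ell i else if l = i then x - C.ell i else 0 := rfl
@[simp] theorem coord_bot (i l : Fin g) (x h0 h1) :
    C.coord i (Point.interior (C.bot l) x h0 h1) =
      if l < i then -C.ell i else if l = i then -x - C.ell i else 0 := rfl
@[simp] theorem coord_bri (i : Fin g) (l : Fin (g - 1)) (x h0 h1) :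
    C.coord i (Point.interior (C.bri l) x h0 h1) = if l.1 < i.1 then -C.ell i else 0 := rfl

/-- The Abel-Jacobi map of the `i`th loop. -/
def jac (i : Fin g) : C.graph.Divisor →+ AddCircle (C.ell i + C.m i) :=
  weigh fun p => (C.coord i p : AddCircle (C.ell i + C.m i))

@[simp] theorem jac_single (i : Fin g) (p : C.graph.Point) (a : ℤ) :
    C.jac i (Finsupp.single p a) = a • (C.coord i p : AddCircle (C.ell i + C.m i)) := by
  simp [jac]

theorem jac_eq_coe (i : Fin g) (Z : C.graph.Divisor) :
    C.jac i Z = ((weigh (C.coord i) Z : ℝ) : AddCircle (C.ell i + C.m i)) := by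
  induction Z using Finsupp.induction_linear with
  | zero => simp
  | add f h hf hh => simp only [map_add, hf, hh, AddCircle.coe_add]
  | single p a => rw [jac_single, weigh_single, AddCircle.coe_zsmul]

@[simp] theorem vtxL_inj {i j : Fin g} : C.vtxL i = C.vtxL j ↔ i = j :=
  ⟨fun h => Sum.inl_injective (Point.vertex.inj h), fun h => by rw [h]⟩
@[simp] theorem vtxR_inj {i j : Fin g} : C.vtxR i = C.vtxR j ↔ i = j :=
  ⟨fun h => Sum.inr_injective (Point.vertex.inj h), fun h => by rw [h]⟩
@[simp] theorem vtxL_ne_vtxR (i j : Fin g) : C.vtxL i ≠ C.vtxR j := nofun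
@[simp] theorem vtxR_ne_vtxL (i j : Fin g) : C.vtxR i ≠ C.vtxL j := nofun
@[simp] theorem interior_ne_vtxL (i : Fin g) (e x h0 h1) :
    Point.interior e x h0 h1 ≠ C.vtxL i := nofun
@[simp] theorem interior_ne_vtxR (i : Fin g) (e x h0 h1) :
    Point.interior e x h0 h1 ≠ C.vtxR i := nofun

@[simp] theorem before_vtxL (e) (y : ℝ) (i : Fin g) : before e y (C.vtxL i) = 0 := rfl
@[simp] theorem before_vtxR (e) (y : ℝ) (i : Fin g) : before e y (C.vtxR i) = 0 := rfl
@[simp] theorem kink_vtxL (e) (y : ℝ) (i : Fin g) : kink e y (C.vtxL i) = 0 := rfl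
@[simp] theorem kink_vtxR (e) (y : ℝ) (i : Fin g) : kink e y (C.vtxR i) = 0 := rfl

theorem degBefore_loop (i : Fin g) (Z : C.graph.Divisor) :
    C.degBefore (2 * i + 1) Z - C.degBefore (2 * i) Z =
      Z (C.vtxL i) + Z (C.vtxR i) + edgeDegree (C.top i) Z + edgeDegree (C.bot i) Z := by
  classical
  simp only [edgeDegree_eq_weigh]
  induction Z using Finsupp.induction_linear with
  | zero => simp
  | add f h hf hh => simp only [map_add, Finsupp.add_apply]; linarith
  | single p a =>
    simp only [degBefore_single, weigh_single, Finsupp.single_apply]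
    induction p using point_cases with
    | hL l | hR l =>
      simp only [pos_vtxL, pos_vtxR, vtxL_inj, vtxR_inj, vtxL_ne_vtxR, vtxR_ne_vtxL, before_vtxL,
        before_vtxR, if_false, Fin.ext_iff, smul_zero]
      split_ifs <;> omega
    | ht l x h0 h1 | hb l x h0 h1 =>
      by_cases h : l = i
      · subst h
        simp [before, h1, -len_top, -len_bot]
      · simp only [pos_top, pos_bot, interior_ne_vtxL, interior_ne_vtxR, before, top_inj, bot_inj,
          bot_ne_top, top_ne_bot, h, if_false, false_and, smul_zero]
        rw [Fin.ext_iff] at h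
        split_ifs <;> omega
    | hbr l x h0 h1 =>
      simp only [pos_bri, interior_ne_vtxL, interior_ne_vtxR, before, bri_ne_top, bri_ne_bot,
        if_false, false_and, smul_zero]
      split_ifs <;> omega

theorem degBefore_bridge (i : Fin (g - 1)) (Z : C.graph.Divisor) :
    C.degBefore (2 * i + 2) Z - C.degBefore (2 * i + 1) Z = edgeDegree (C.bri i) Z := by
  classical
  simp only [edgeDegree_eq_weigh]
  induction Z using Finsupp.induction_linear with
  | zero => simp
  | add f h hf hh => simp only [map_add]; linarith
  | single p a =>
    simp only [degBefore_single, weigh_single]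
    induction p using point_cases with
    | hL l | hR l =>
      simp only [pos_vtxL, pos_vtxR, before_vtxL, before_vtxR, smul_zero]
      split_ifs <;> omega
    | ht l x h0 h1 | hb l x h0 h1 =>
      simp only [pos_top, pos_bot, before, top_ne_bri, bot_ne_bri, if_false, false_and, smul_zero]
      split_ifs <;> omega
    | hbr l x h0 h1 =>
      by_cases h : l = i
      · subst h
        simp [before, h1]
      · simp only [pos_bri, before, bri_inj, h, false_and, if_false, smul_zero]
        rw [Fin.ext_iff] at h
        split_ifs <;> omega

/-- A real lift of `jac i Z`, expressed through the quantities that give the rise of a function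
along the two edges of the loop. Both sides are additive in `Z`, so single points suffice. -/
theorem weigh_coord (i : Fin g) (Z : C.graph.Divisor) :
    weigh (C.coord i) Z = -C.ell i * C.degBefore (2 * i + 1) Z +
      (C.ell i * edgeDegree (C.top i) Z - kinkSum Z (C.top i) (C.ell i)) -
      (C.m i * edgeDegree (C.bot i) Z - kinkSum Z (C.bot i) (C.m i)) + C.ell i * Z (C.vtxR i) := by
  classical
  simp only [edgeDegree_eq_weigh, kinkSum_eq_weigh]
  induction Z using Finsupp.induction_linear with
  | zero => simp
  | add f h hf hh => simp only [map_add, Finsupp.add_apply, hf, hh]; push_cast; ring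
  | single p a =>
    simp only [degBefore_single, weigh_single, Finsupp.single_apply]
    induction p using point_cases with
    | hL l =>
      by_cases h : l ≤ i <;> simp [h, mul_comm]
    | hR l =>
      rcases lt_trichotomy l i with h | h | h
      · simp [h, h.ne, h.le, mul_comm]
      · subst h; simp [mul_comm]
      · have : ¬ (2 * l.1 < 2 * i.1 + 1) := by rw [Fin.lt_def] at h; omega
        simp [this, h.not_gt, h.ne']
    | ht l x h0 h1 =>
      rcases lt_trichotomy l i with h | h | h
      · simp [h, h.ne, h.le, mul_comm, before, kink]
      · subst h
        have h1' := h1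
        simp only [len_top] at h1'
        simp [before, kink, h1', h1'.le]
        ring
      · have : ¬ (2 * l.1 < 2 * i.1 + 1) := by rw [Fin.lt_def] at h; omega
        simp [this, h.not_gt, h.ne', before, kink]
    | hb l x h0 h1 =>
      rcases lt_trichotomy l i with h | h | h
      · simp [h, h.ne, h.le, mul_comm, before, kink]
      · subst h
        have h1' := h1
        simp only [len_bot] at h1'
        simp [before, kink, h1', h1'.le]
        ring
      · have : ¬ (2 * l.1 < 2 * i.1 + 1) := by rw [Fin.lt_def] at h; omega
        simp [this, h.not_gt, h.ne', before, kink]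
    | hbr l x h0 h1 =>
      by_cases h : l.1 < i.1 <;> simp [h, before, kink, mul_comm]

theorem sum_edges {M : Type*} [AddCommMonoid M] (h : C.graph.E → M) :
    ∑ e, h e = ∑ i, h (C.top i) + (∑ i, h (C.bot i) + ∑ i, h (C.bri i)) :=
  (Fintype.sum_sum_type (α₁ := Fin g) (α₂ := Fin g ⊕ Fin (g - 1)) h).trans
    (congrArg _ (Fintype.sum_sum_type (α₁ := Fin g) (α₂ := Fin (g - 1))
      (fun e => h (Sum.inr e : Fin g ⊕ Fin g ⊕ Fin (g - 1)))))

/-! ### Edges meeting a given vertex -/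

section incidence

open Classical

variable {M : Type*} [AddCommMonoid M] (h : C.graph.E → M) (i : Fin g)

theorem sum_src_idL :
    ∑ e, (if C.graph.src e = C.idL i then h e else 0) = h (C.top i) + h (C.bot i) := by
  have e1 : ∀ l, (C.graph.src (C.top l) = C.idL i) = (l = i) :=
    fun l => propext (show (Sum.inl l : Fin g ⊕ Fin g) = Sum.inl i ↔ _ by simp)
  have e2 : ∀ l, (C.graph.src (C.bot l) = C.idL i) = (l = i) :=
    fun l => propext (show (Sum.inl l : Fin g ⊕ Fin g) = Sum.inl i ↔ _ by simp)
  have e3 : ∀ l, ¬ (C.graph.src (C.bri l) = C.idL i) := fun l => nofun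
  simp [sum_edges, e1, e2, e3]

theorem sum_tgt_idL :
    ∑ e, (if C.graph.tgt e = C.idL i then h e else 0) =
      if hi : 0 < i.1 ∧ i.1 - 1 < g - 1 then h (C.bri ⟨i.1 - 1, hi.2⟩) else 0 := by
  have e1 : ∀ l, ¬ (C.graph.tgt (C.top l) = C.idL i) := fun l => nofun
  have e2 : ∀ l, ¬ (C.graph.tgt (C.bot l) = C.idL i) := fun l => nofun
  have e3 : ∀ l, (C.graph.tgt (C.bri l) = C.idL i) = (l.1 + 1 = i.1) :=
    fun l => propext (show (Sum.inl ⟨l.1 + 1, _⟩ : Fin g ⊕ Fin g) = Sum.inl i ↔ _ by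
      simp [Fin.ext_iff])
  simp only [sum_edges, e1, e2, e3, if_false, Finset.sum_const_zero, zero_add]
  split_ifs with hi
  · rw [Finset.sum_eq_single ⟨i.1 - 1, hi.2⟩, if_pos (by simp only; omega)]
    · exact fun b _ hb => if_neg fun h' => hb (Fin.ext (by simp only; omega))
    · simp
  · exact Finset.sum_eq_zero fun b _ => if_neg fun h' => hi ⟨by omega, by have := b.2; omega⟩

theorem sum_src_idR :
    ∑ e, (if C.graph.src e = C.idR i then h e else 0) =
      if hi : i.1 < g - 1 then h (C.bri ⟨i.1, hi⟩) else 0 := by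
  have e1 : ∀ l, ¬ (C.graph.src (C.top l) = C.idR i) := fun l => nofun
  have e2 : ∀ l, ¬ (C.graph.src (C.bot l) = C.idR i) := fun l => nofun
  have e3 : ∀ l, (C.graph.src (C.bri l) = C.idR i) = (l.1 = i.1) :=
    fun l => propext (show (Sum.inr ⟨l.1, _⟩ : Fin g ⊕ Fin g) = Sum.inr i ↔ _ by
      simp [Fin.ext_iff])
  simp only [sum_edges, e1, e2, e3, if_false, Finset.sum_const_zero, zero_add]
  split_ifs with hi
  · rw [Finset.sum_eq_single ⟨i.1, hi⟩, if_pos rfl]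
    · exact fun b _ hb => if_neg fun h' => hb (Fin.ext h')
    · simp
  · exact Finset.sum_eq_zero fun b _ => if_neg fun h' => hi (by have := b.2; omega)

theorem sum_tgt_idR :
    ∑ e, (if C.graph.tgt e = C.idR i then h e else 0) = h (C.top i) + h (C.bot i) := by
  have e1 : ∀ l, (C.graph.tgt (C.top l) = C.idR i) = (l = i) :=
    fun l => propext (show (Sum.inr l : Fin g ⊕ Fin g) = Sum.inr i ↔ _ by simp)
  have e2 : ∀ l, (C.graph.tgt (C.bot l) = C.idR i) = (l = i) :=
    fun l => propext (show (Sum.inr l : Fin g ⊕ Fin g) = Sum.inr i ↔ _ by simp)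
  have e3 : ∀ l, ¬ (C.graph.tgt (C.bri l) = C.idR i) := fun l => nofun
  simp [sum_edges, e1, e2, e3]

end incidence

/-! ### Principal divisors have degree zero and trivial Abel-Jacobi images -/

variable {C}

/-- The slope with which a function reaches the left vertex of the `i`th loop. -/
def slopeIn (f : C.graph.Point → ℝ) (i : ℕ) : ℤ :=
  if h : 0 < i ∧ i - 1 < g - 1 then endSlope f (C.bri ⟨i - 1, h.2⟩) else 0

/-- The slope with which a function leaves the right vertex of the `i`th loop. -/
def slopeOut (f : C.graph.Point → ℝ) (i : ℕ) : ℤ :=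
  if h : i < g - 1 then startSlope f (C.bri ⟨i, h⟩) else 0

theorem ord_vtxL (f : C.graph.Point → ℝ) (i : Fin g) :
    C.graph.ord f (C.vtxL i) =
      -startSlope f (C.top i) - startSlope f (C.bot i) + slopeIn f i := by
  rw [vtxL, ord_vertex, sum_src_idL, sum_tgt_idL, slopeIn, ← sub_eq_add_neg]

theorem ord_vtxR (f : C.graph.Point → ℝ) (i : Fin g) :
    C.graph.ord f (C.vtxR i) = endSlope f (C.top i) + endSlope f (C.bot i) - slopeOut f i := by
  rw [vtxR, ord_vertex, sum_src_idR C fun e => -startSlope f e, sum_tgt_idR, slopeOut]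
  split_ifs <;> ring

section slopes

variable {f : C.graph.Point → ℝ} {Z : C.graph.Divisor}

theorem slope_loop (hf : C.graph.IsPL f) (hZ : ∀ p, C.graph.ord f p = Z p) (i : Fin g) :
    slopeIn f i - slopeOut f i = C.degBefore (2 * i + 1) Z - C.degBefore (2 * i) Z := by
  have h1 := hZ (C.vtxL i)
  have h2 := hZ (C.vtxR i)
  rw [ord_vtxL] at h1
  rw [ord_vtxR, hf.endSlope_eq hZ, hf.endSlope_eq hZ] at h2
  rw [degBefore_loop, ← h1, ← h2]
  ring

theorem slopeIn_succ (hf : C.graph.IsPL f) (hZ : ∀ p, C.graph.ord f p = Z p) {i : ℕ}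
    (hi : i + 1 < g) :
    slopeIn f (i + 1) = slopeOut f i - (C.degBefore (2 * i + 2) Z - C.degBefore (2 * i + 1) Z) := by
  have hi' : i < g - 1 := by omega
  rw [C.degBefore_bridge ⟨i, hi'⟩, slopeIn, slopeOut, dif_pos hi', dif_pos ⟨by omega, by simpa⟩]
  simp only [Nat.add_sub_cancel]
  exact hf.endSlope_eq hZ _

/-- A bridge separates the chain, so the slope across it is determined by the total order of `f` to
its left. At `i = 0` both sides are zero. -/
theorem slopeIn_eq (hf : C.graph.IsPL f) (hZ : ∀ p, C.graph.ord f p = Z p) :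
    ∀ {i : ℕ}, i < g → slopeIn f i = -C.degBefore (2 * i) Z
  | 0, _ => by simp [slopeIn]
  | i + 1, hi => by
    have h1 := slopeIn_eq hf hZ (i := i) (by omega)
    have h2 := slope_loop hf hZ ⟨i, by omega⟩
    rw [slopeIn_succ hf hZ hi]
    simp only at h2
    rw [show 2 * (i + 1) = 2 * i + 2 by ring]
    linarith

theorem slopeOut_eq (hf : C.graph.IsPL f) (hZ : ∀ p, C.graph.ord f p = Z p) {i : ℕ} (hi : i < g) :
    slopeOut f i = -C.degBefore (2 * i + 1) Z := by
  have h1 := slopeIn_eq hf hZ hi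
  have h2 := slope_loop hf hZ ⟨i, hi⟩
  simp only at h2
  linarith

theorem degree_eq_zero_of_ord (hf : C.graph.IsPL f) (hZ : ∀ p, C.graph.ord f p = Z p) :
    degree Z = 0 := by
  rcases Nat.eq_zero_or_pos g with rfl | hg
  · rw [← C.degBefore_eq_degree (c := 0) (by omega), degBefore_zero]
  -- No bridge leaves the last loop, so `slopeOut` takes its default value zero there.
  have h := slopeOut_eq hf hZ (i := g - 1) (by omega)
  rw [slopeOut, dif_neg (lt_irrefl _), C.degBefore_eq_degree (by omega)] at h
  linarith

theorem apply_vtxR_top (hf : C.graph.IsPL f) (hZ : ∀ p, C.graph.ord f p = Z p) (i : Fin g) :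
    f (C.vtxR i) = f (C.vtxL i) + startSlope f (C.top i) * C.ell i -
      kinkSum Z (C.top i) (C.ell i) := hf.apply_tgt hZ (C.top i)

theorem apply_vtxR_bot (hf : C.graph.IsPL f) (hZ : ∀ p, C.graph.ord f p = Z p) (i : Fin g) :
    f (C.vtxR i) = f (C.vtxL i) + startSlope f (C.bot i) * C.m i -
      kinkSum Z (C.bot i) (C.m i) := hf.apply_tgt hZ (C.bot i)

/-- The two edges of a loop give the same rise of `f` from the left to the right vertex. Comparing
the two expressions makes the lift of `jac i Z` an integer multiple of the circumference. -/
theorem jac_eq_zero_of_ord (hf : C.graph.IsPL f) (hZ : ∀ p, C.graph.ord f p = Z p) (i : Fin g) :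
    C.jac i Z = 0 := by
  rw [jac_eq_coe, AddCircle.coe_eq_zero_iff]
  -- The integer is the slope with which the second edge enters the right vertex.
  refine ⟨endSlope f (C.bot i), ?_⟩
  have h1 := apply_vtxR_top hf hZ i
  have h2 := apply_vtxR_bot hf hZ i
  have h3 := hZ (C.vtxR i)
  have h4 := slopeOut_eq hf hZ i.2
  have h5 := hf.endSlope_eq hZ (C.top i)
  have h6 := hf.endSlope_eq hZ (C.bot i)
  rw [ord_vtxR, h4] at h3
  rw [weigh_coord, ← h3, zsmul_eq_mul, h5, h6]
  push_cast
  linear_combination h1 - h2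

end slopes

theorem degree_eq_of_equivalent {D D' : C.graph.Divisor} (h : Equivalent D D') :
    degree D = degree D' := by
  obtain ⟨f, hf, hD⟩ := h
  have := degree_eq_zero_of_ord hf (Z := D' - D) fun p => by
    rw [Finsupp.sub_apply, ← hD]; ring
  rw [degree_eq_weigh, map_sub, ← degree_eq_weigh, ← degree_eq_weigh] at this
  linarith

theorem jac_eq_of_equivalent {D D' : C.graph.Divisor} (h : Equivalent D D') (i : Fin g) :
    C.jac i D = C.jac i D' := by
  obtain ⟨f, hf, hD⟩ := h
  have := jac_eq_zero_of_ord hf (Z := D' - D) (fun p => by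
    rw [Finsupp.sub_apply, ← hD]; ring) i
  rw [map_sub] at this
  exact (sub_eq_zero.1 this).symm

end ChainOfLoops

namespace MetricGraph

variable {G : MetricGraph}

theorem kinkSum_eq_zero {Z : G.Divisor} {e : G.E}
    (hZ : ∀ x h0 h1, Z (Point.interior e x h0 h1) = 0) (y : ℝ) : kinkSum Z e y = 0 := by
  refine Finset.sum_eq_zero fun p _ => ?_
  cases p with
  | vertex v => simp [kink]
  | interior e' x h0 h1 =>
    by_cases h : e' = e
    · subst h; simp [hZ]
    · simp [kink, h]

theorem edgeDegree_eq_zero_of_interior {Z : G.Divisor} {e : G.E}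
    (hZ : ∀ x h0 h1, Z (Point.interior e x h0 h1) = 0) : edgeDegree e Z = 0 :=
  edgeDegree_eq_zero (fun x h0 h1 => (hZ x h0 h1).ge) (kinkSum_eq_zero hZ _)

theorem canonical_vertex (v : G.V) :
    G.canonical (Point.vertex v) = (G.valence v : ℤ) - 2 := by
  classical
  simp [canonical, Finsupp.single_apply]

theorem canonical_interior (e : G.E) (x h0 h1) :
    G.canonical (Point.interior e x h0 h1) = 0 := by
  classical
  simp [canonical]

end MetricGraph

/-! ### Converse of Abel's theorem, coordinates on the loops, the canonical divisor -/

namespace ChainOfLoops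

open MetricGraph

variable {g : ℕ} {C : ChainOfLoops g}

/-- A divisor of degree zero in the kernel of the Abel-Jacobi maps is principal. -/
theorem exists_ord_eq (Z : C.graph.Divisor) (hdeg : degree Z = 0) (hjac : ∀ i, C.jac i Z = 0) :
    ∃ f, C.graph.IsPL f ∧ ∀ p, C.graph.ord f p = Z p := by
  have hn : ∀ i, ∃ n : ℤ, n • (C.ell i + C.m i) = weigh (C.coord i) Z := fun i => by
    have := hjac i
    rwa [jac_eq_coe, AddCircle.coe_eq_zero_iff] at this
  choose n hn using hn
  -- As in `jac_eq_zero_of_ord`, `n i` is to be the slope with which the second edge enters the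
  -- right vertex. The order at that vertex then forces `s₁`, and the degree to the left of a bridge
  -- forces `s₃`.
  let s₁ : Fin g → ℤ := fun i =>
    Z (C.vtxR i) - C.degBefore (2 * i + 1) Z - n i + edgeDegree (C.top i) Z
  let s₂ : Fin g → ℤ := fun i => n i + edgeDegree (C.bot i) Z
  let s₃ : Fin (g - 1) → ℤ := fun i => -C.degBefore (2 * i + 1) Z
  let s : C.graph.E → ℤ := (Sum.elim s₁ (Sum.elim s₂ s₃) : Fin g ⊕ Fin g ⊕ Fin (g - 1) → ℤ)
  let rise : Fin g → ℝ := fun i => s₁ i * C.ell i - kinkSum Z (C.top i) (C.ell i)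
  let riseB : Fin (g - 1) → ℝ := fun i => s₃ i * C.bridge i - kinkSum Z (C.bri i) (C.bridge i)
  let total : ℕ → ℝ := fun l =>
    (if h : l < g then rise ⟨l, h⟩ else 0) + if h : l < g - 1 then riseB ⟨l, h⟩ else 0
  let val : ℕ → ℝ := fun i => ∑ l ∈ Finset.range i, total l
  let c : C.graph.V → ℝ :=
    (Sum.elim (fun i => val i) (fun i => val i + rise i) : Fin g ⊕ Fin g → ℝ)
  have hc : ∀ e, c (C.graph.tgt e) =
      c (C.graph.src e) + s e * C.graph.len e - kinkSum Z e (C.graph.len e) := by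
    rintro (i | i | i)
    · change val i + rise i = val i + s₁ i * C.ell i - kinkSum Z (C.top i) (C.ell i)
      simp only [rise]; ring
    -- Both edges of the loop reach the same value precisely because the lift of `jac i Z` is `n i`
    -- times the circumference.
    · change val i + rise i = val i + s₂ i * C.m i - kinkSum Z (C.bot i) (C.m i)
      have := hn i
      rw [weigh_coord, zsmul_eq_mul] at this
      simp only [rise, s₁, s₂]
      push_cast
      linear_combination -this
    · change val (i + 1) = (val i + rise ⟨i, _⟩) + s₃ i * C.bridge i -
        kinkSum Z (C.bri i) (C.bridge i)
      have hi := i.2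
      simp only [val, Finset.sum_range_succ, total]
      rw [dif_pos (by omega), dif_pos hi]
      simp only [riseB]; ring
  have hpl := isPL_ofKinks hc
  have hstart : ∀ e, startSlope (ofKinks Z c s) e = s e := startSlope_ofKinks hc
  have hend : ∀ e, endSlope (ofKinks Z c s) e = s e - edgeDegree e Z := endSlope_ofKinks hc
  have hs1 : ∀ i, s (C.top i) = s₁ i := fun i => rfl
  have hs2 : ∀ i, s (C.bot i) = s₂ i := fun i => rfl
  have hs3 : ∀ i, s (C.bri i) = s₃ i := fun i => rfl
  refine ⟨_, hpl, fun p => ?_⟩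
  induction p using point_cases with
  | hL i =>
    have hin : slopeIn (ofKinks Z c s) i = -C.degBefore (2 * i) Z := by
      rw [slopeIn]
      split_ifs with h
      · rw [hend, hs3]
        have h2 := C.degBefore_bridge ⟨i.1 - 1, h.2⟩ Z
        simp only [s₃] at h2 ⊢
        rw [show 2 * (i.1 - 1) + 2 = 2 * i.1 by omega] at h2
        rw [← h2]; ring
      · have : i.1 = 0 := by have := i.2; omega
        rw [this]; simp
    rw [ord_vtxL, hin, hstart, hstart, hs1, hs2]
    have := C.degBefore_loop i Z
    simp only [s₁, s₂]
    linarith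
  | hR i =>
    have hout : slopeOut (ofKinks Z c s) i = -C.degBefore (2 * i + 1) Z := by
      rw [slopeOut]
      split_ifs with h
      · rw [hstart, hs3]
      -- The last vertex has no outgoing bridge to balance its order; degree zero takes its place.
      · rw [C.degBefore_eq_degree (by have := i.2; omega), hdeg]; rfl
    rw [ord_vtxR, hout, hend, hend, hs1, hs2]
    simp only [s₁, s₂]
    ring
  | ht i x h0 h1 => exact ord_ofKinks_interior hc _ _ _
  | hb i x h0 h1 => exact ord_ofKinks_interior hc _ _ _
  | hbr i x h0 h1 => exact ord_ofKinks_interior hc _ _ _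

theorem equivalent_of_jac_eq {D D' : C.graph.Divisor} (hdeg : degree D = degree D')
    (hjac : ∀ i, C.jac i D = C.jac i D') : Equivalent D D' := by
  obtain ⟨f, hf, hZ⟩ := exists_ord_eq (D' - D)
    (by rw [degree_eq_weigh, map_sub, ← degree_eq_weigh, ← degree_eq_weigh, hdeg, sub_self])
    (fun i => by rw [map_sub, hjac, sub_self])
  exact ⟨f, hf, fun p => by rw [hZ, Finsupp.sub_apply]; ring⟩

/-! ### Points on a loop -/

variable (C) in
/-- The point on the `i`th loop with coordinate `y`, for `-ell i ≤ y < m i`. -/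
def loopPoint (i : Fin g) (y : ℝ) : C.graph.Point :=
  if y < 0 then C.graph.pt (C.top i) (y + C.ell i) else C.graph.pt (C.bot i) (C.m i - y)

theorem loopPoint_spec (i : Fin g) {y : ℝ}
    (hy : y ∈ Set.Ico (-C.ell i) (-C.ell i + (C.ell i + C.m i))) :
    C.pos (C.loopPoint i y) = 2 * i ∧
      (C.coord i (C.loopPoint i y) : AddCircle (C.ell i + C.m i)) = (y : ℝ) := by
  obtain ⟨hy0, hy1⟩ := hy
  rw [loopPoint]
  split_ifs with h
  · rcases hy0.lt_or_eq with h' | h'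
    · rw [pt_of_mem _ (by linarith) (by rw [len_top]; linarith)]
      exact ⟨rfl, by simp⟩
    · rw [pt_of_nonpos _ (by linarith)]
      refine ⟨rfl, ?_⟩
      change ((C.coord i (C.vtxL i) : ℝ) : AddCircle (C.ell i + C.m i)) = _
      simp [← h']
  · push Not at h
    rcases h.lt_or_eq with h' | h'
    · rw [pt_of_mem _ (by linarith) (by rw [len_bot]; linarith)]
      refine ⟨rfl, ?_⟩
      rw [coord_bot, if_neg (lt_irrefl _), if_pos rfl, ← sub_eq_zero, ← AddCircle.coe_sub,
        AddCircle.coe_eq_zero_iff]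
      -- The coordinate used on the second edge differs from `y` by one full turn.
      exact ⟨-1, by simp; ring⟩
    · rw [pt_of_le _ (by rw [len_bot]; linarith)]
      refine ⟨rfl, ?_⟩
      change ((C.coord i (C.vtxR i) : ℝ) : AddCircle (C.ell i + C.m i)) = _
      simp [← h']

theorem exists_eq_loopPoint {i : Fin g} {p : C.graph.Point} (hp : C.pos p = 2 * i) :
    ∃ y ∈ Set.Ico (-C.ell i) (-C.ell i + (C.ell i + C.m i)), p = C.loopPoint i y := by
  have hl := C.ell_pos i
  have hm := C.m_pos i
  induction p using point_cases with
  | hL l =>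
    obtain rfl : l = i := Fin.ext (by simpa using hp)
    refine ⟨-C.ell l, ⟨le_rfl, by linarith⟩, ?_⟩
    rw [loopPoint, if_pos (by linarith), pt_of_nonpos _ (by linarith)]
    rfl
  | hR l =>
    obtain rfl : l = i := Fin.ext (by simpa using hp)
    refine ⟨0, ⟨by linarith, by linarith⟩, ?_⟩
    rw [loopPoint, if_neg (lt_irrefl _), pt_of_le _ (by rw [len_bot]; linarith)]
    rfl
  | ht l x h0 h1 =>
    obtain rfl : l = i := Fin.ext (by simpa using hp)
    have h1' := h1
    rw [len_top] at h1'
    refine ⟨x - C.ell l, ⟨by linarith, by linarith⟩, ?_⟩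
    rw [loopPoint, if_pos (by linarith), sub_add_cancel, pt_of_mem _ h0 h1]
  | hb l x h0 h1 =>
    obtain rfl : l = i := Fin.ext (by simpa using hp)
    have h1' := h1
    rw [len_bot] at h1'
    refine ⟨C.m l - x, ⟨by linarith, by linarith⟩, ?_⟩
    rw [loopPoint, if_neg (by linarith), sub_sub_cancel, pt_of_mem _ h0 h1]
  | hbr l x h0 h1 => simp at hp; omega

/-- `loopPoint` parametrizes the loop by a half-open interval of one circumference, on which
reduction to the circle is injective. -/
theorem eq_of_coord_eq {i : Fin g} {p q : C.graph.Point} (hp : C.pos p = 2 * i)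
    (hq : C.pos q = 2 * i) (h : (C.coord i p : AddCircle (C.ell i + C.m i)) = C.coord i q) :
    p = q := by
  obtain ⟨y, hy, rfl⟩ := exists_eq_loopPoint hp
  obtain ⟨z, hz, rfl⟩ := exists_eq_loopPoint hq
  have : Fact (0 < C.ell i + C.m i) := ⟨add_pos (C.ell_pos i) (C.m_pos i)⟩
  rw [(loopPoint_spec i hy).2, (loopPoint_spec i hz).2,
    AddCircle.coe_eq_coe_iff_of_mem_Ico hy hz] at h
  rw [h]

theorem exists_coord_eq (i : Fin g) (θ : AddCircle (C.ell i + C.m i)) :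
    ∃ p : C.graph.Point, C.pos p = 2 * i ∧ (C.coord i p : AddCircle (C.ell i + C.m i)) = θ := by
  have : Fact (0 < C.ell i + C.m i) := ⟨add_pos (C.ell_pos i) (C.m_pos i)⟩
  have : θ ∈ ((↑) : ℝ → AddCircle (C.ell i + C.m i)) ''
      Set.Ico (-C.ell i) (-C.ell i + (C.ell i + C.m i)) := by
    rw [AddCircle.coe_image_Ico_eq]; trivial
  obtain ⟨y, hy, rfl⟩ := this
  exact ⟨_, loopPoint_spec i hy⟩

/-! ### The canonical divisor -/

theorem canonical_vtxL (i : Fin g) : C.graph.canonical (C.vtxL i) = if i.1 = 0 then 0 else 1 := by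
  rw [vtxL, canonical_vertex, valence, sum_src_idL C fun _ => 1, sum_tgt_idL C fun _ => 1]
  have := i.2
  split_ifs <;> omega

theorem canonical_vtxR (i : Fin g) :
    C.graph.canonical (C.vtxR i) = if i.1 + 1 = g then 0 else 1 := by
  rw [vtxR, canonical_vertex, valence, sum_src_idR C fun _ => 1, sum_tgt_idR C fun _ => 1]
  have := i.2
  split_ifs <;> omega

theorem degBefore_canonical_loop (i : Fin g) :
    C.degBefore (2 * i + 1) C.graph.canonical = C.degBefore (2 * i) C.graph.canonical +
      (if i.1 = 0 then 0 else 1) + if i.1 + 1 = g then 0 else 1 := by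
  have h := C.degBefore_loop i C.graph.canonical
  rw [edgeDegree_eq_zero_of_interior (canonical_interior _),
    edgeDegree_eq_zero_of_interior (canonical_interior _), canonical_vtxL, canonical_vtxR] at h
  linarith

theorem degBefore_canonical_even : ∀ {i : ℕ}, i + 1 < g →
    C.degBefore (2 * i + 2) C.graph.canonical = 2 * i + 1
  | 0, hi => by
    have h := C.degBefore_bridge ⟨0, by omega⟩ C.graph.canonical
    have h1 := degBefore_canonical_loop (C := C) ⟨0, by omega⟩
    rw [edgeDegree_eq_zero_of_interior (canonical_interior _)] at h
    simp only [mul_zero, degBefore_zero, zero_add, if_true, if_neg hi.ne] at h h1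
    simp
    linarith
  | i + 1, hi => by
    have h0 := degBefore_canonical_even (i := i) (by omega)
    have h := C.degBefore_bridge ⟨i + 1, by omega⟩ C.graph.canonical
    have h1 := degBefore_canonical_loop (C := C) ⟨i + 1, by omega⟩
    rw [edgeDegree_eq_zero_of_interior (canonical_interior _)] at h
    simp only [if_neg hi.ne, if_neg (Nat.succ_ne_zero i)] at h h1
    rw [show 2 * (i + 1) = 2 * i + 2 by ring, h0] at h1
    rw [show 2 * (i + 1) = 2 * i + 2 by ring] at h ⊢
    push_cast
    linarith

/-- Every bridge contributes a chip at each of its two ends: the `i` earlier bridges count twice,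
and the `i`th one only with its left end. -/
theorem degBefore_canonical {i : ℕ} (hi : i + 1 < g) :
    C.degBefore (2 * i + 1) C.graph.canonical = 2 * i + 1 := by
  have h := C.degBefore_bridge ⟨i, by omega⟩ C.graph.canonical
  rw [edgeDegree_eq_zero_of_interior (canonical_interior _), degBefore_canonical_even hi] at h
  simp only at h
  linarith

theorem degree_canonical (hg : 0 < g) : degree C.graph.canonical = 2 * g - 2 := by
  obtain ⟨n, rfl⟩ := Nat.exists_eq_succ_of_ne_zero hg.ne'
  rw [← C.degBefore_eq_degree (c := 2 * n + 1) (by omega)]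
  have h1 := degBefore_canonical_loop (C := C) ⟨n, by omega⟩
  simp only [if_true] at h1
  rw [h1]
  rcases n with _ | n
  · simp
  · rw [show 2 * (n + 1) = 2 * n + 2 by ring, degBefore_canonical_even (by omega)]
    simp; ring

/-- The `i` bridges to the left of the loop contribute `2 * i` chips at coordinate `-ell i`; all the
others lie at the origin after retraction. -/
theorem jac_canonical (i : Fin g) :
    C.jac i C.graph.canonical = (-(2 * i : ℤ)) • (C.ell i : AddCircle (C.ell i + C.m i)) := by
  rw [jac_eq_coe, weigh_coord, edgeDegree_eq_zero_of_interior (canonical_interior _),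
    edgeDegree_eq_zero_of_interior (canonical_interior _), kinkSum_eq_zero (canonical_interior _),
    kinkSum_eq_zero (canonical_interior _), canonical_vtxR, ← AddCircle.coe_zsmul]
  congr 1
  by_cases h : i.1 + 1 = g
  · rw [C.degBefore_eq_degree (by omega), degree_canonical (by omega), if_pos h]
    have : (g : ℝ) = i.1 + 1 := by exact_mod_cast h.symm
    rw [zsmul_eq_mul]
    push_cast
    rw [this]; ring
  · rw [degBefore_canonical (by have := i.2; omega), if_neg h, zsmul_eq_mul]
    push_cast
    ring

end ChainOfLoops

/-! ### Beads climbing on levels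

`U i z` says that a bead at level `z` may climb to level `z + 1` at time `i`. -/

section Beads

open Classical in
/-- The level of the `k`th bead at time `i`. Initially it is at level `s - k`; at time `i` it
climbs if this is allowed and if the next level is not occupied by an earlier bead. -/
def bead (s : ℤ) (U : ℕ → ℤ → Prop) : ℕ → ℕ → ℤ
  | 0, k => s - k
  | i + 1, k =>
    if U i (bead s U i k) ∧ ∀ k' < k, bead s U i k' ≠ bead s U i k + 1 then bead s U i k + 1
    else bead s U i k

/-- A path of levels up to time `n`: it falls by at least `F i` right before time `i`, it climbs by
at most one at time `i`, and only if `U i` allows this. -/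
structure IsPath (s : ℤ) (U : ℕ → ℤ → Prop) (F : ℕ → ℕ) (n : ℕ) (x : ℕ → ℤ) : Prop where
  start : x 0 + F 0 ≤ s
  step : ∀ i < n, x (i + 1) + F (i + 1) ≤ x i + 1
  step' : ∀ i < n, ¬ U i (x i) → x (i + 1) + F (i + 1) ≤ x i

variable {s : ℤ} {U : ℕ → ℤ → Prop}

theorem bead_succ_le (i k : ℕ) : bead s U (i + 1) k ≤ bead s U i k + 1 := by
  rw [bead]; split_ifs <;> omega

theorem le_bead_succ (i k : ℕ) : bead s U i k ≤ bead s U (i + 1) k := by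
  rw [bead]; split_ifs <;> omega

/-- Beads never collide because one climbs only when no earlier bead occupies the next level. -/
theorem bead_strictAnti (i : ℕ) : StrictAnti (bead s U i) := by
  refine strictAnti_nat_of_succ_lt fun k => ?_
  induction i with
  | zero => simp [bead]
  | succ i ih =>
    have h1 := le_bead_succ (s := s) (U := U) i k
    rw [bead]
    split_ifs with h
    · have := h.2 k (Nat.lt_succ_self k)
      omega
    · omega

theorem le_bead (i k : ℕ) : s - k ≤ bead s U i k := by
  induction i with
  | zero => rfl
  | succ i ih => exact ih.trans (le_bead_succ i k)

theorem bead_le (i k : ℕ) : bead s U i k ≤ s - k + i := by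
  induction i with
  | zero => simp [bead]
  | succ i ih => have := bead_succ_le (s := s) (U := U) i k; push_cast; omega

/-- With `k` chips an adversary can force every path below the `k`th bead. -/
theorem exists_forcing (n k : ℕ) (hU : ∀ i < n, ∀ z, U i z → ¬ U i (z + 1)) :
    ∃ F : ℕ → ℕ, (∀ i, n < i → F i = 0) ∧ ∑ i ∈ Finset.range (n + 1), F i = k ∧
      ∀ x, IsPath s U F n x → x n ≤ bead s U n k := by
  induction n generalizing k with
  | zero =>
    refine ⟨fun i => if i = 0 then k else 0, fun i hi => if_neg hi.ne', by simp, fun x hx => ?_⟩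
    have := hx.start
    simp only [if_true] at this
    simp only [bead]
    omega
  | succ n ih =>
    have hU' : ∀ i < n, ∀ z, U i z → ¬ U i (z + 1) := fun i hi => hU i (by omega)
    -- If bead `k` is blocked by an earlier bead `k'` at the last step, the adversary first forces
    -- the path below the blocker with `k'` chips and then spends the remaining `k - k' ≥ 1` chips.
    -- Otherwise the strategy for bead `k` already suffices.
    by_cases hb : ∃ k' < k, U n (bead s U n k) ∧ bead s U n k' = bead s U n k + 1
    · obtain ⟨k', hk', hUk, hbk⟩ := hb
      obtain ⟨F, hF0, hFs, hF⟩ := ih k' hU'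
      refine ⟨fun i => if i = n + 1 then k - k' else F i, fun i hi => ?_, ?_, fun x hx => ?_⟩
      · exact (if_neg (by omega)).trans (hF0 i (by omega))
      · rw [Finset.sum_range_succ, if_pos rfl, Finset.sum_congr rfl (g := F), hFs]
        · omega
        · intro i hi
          have := Finset.mem_range.1 hi
          rw [if_neg (by omega)]
      · have h1 : x n ≤ bead s U n k' := by
          refine hF x ⟨?_, fun i hi => ?_, fun i hi hn => ?_⟩
          · simpa using hx.start
          · have := hx.step i (by omega)
            rwa [if_neg (by omega)] at this
          · have := hx.step' i (by omega) hn
            rwa [if_neg (by omega)] at this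
        have h2 := hx.step n (by omega)
        have h3 := hx.step' n (by omega)
        rw [if_pos rfl] at h2 h3
        have h4 := le_bead_succ (s := s) (U := U) n k
        rcases h1.lt_or_eq with h1 | h1
        · omega
        -- A path at the blocker's level cannot climb, since climbing is allowed at the level just
        -- below.
        · have : ¬ U n (x n) := by rw [h1, hbk]; exact hU n (by omega) _ hUk
          have := h3 this
          omega
    · obtain ⟨F, hF0, hFs, hF⟩ := ih k hU'
      refine ⟨F, fun i hi => hF0 i (by omega), ?_, fun x hx => ?_⟩
      · rw [Finset.sum_range_succ, hFs, hF0 (n + 1) (by omega), add_zero]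
      · have h1 : x n ≤ bead s U n k :=
          hF x ⟨hx.start, fun i hi => hx.step i (by omega), fun i hi => hx.step' i (by omega)⟩
        have h2 := hx.step n (by omega)
        have h3 := hx.step' n (by omega)
        have h4 := le_bead_succ (s := s) (U := U) n k
        rcases h1.lt_or_eq with h1 | h1
        · omega
        · by_cases hu : U n (x n)
          · rw [h1] at hu
            rw [bead, if_pos ⟨hu, fun k' hk' h => hb ⟨k', hk', hu, h⟩⟩]
            omega
          · have := h3 hu
            omega

/-- Genericity: the levels at which a bead may climb at a given time are far apart. -/
def Sparse (g : ℕ) (U : ℕ → ℤ → Prop) : Prop :=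
  ∀ i < g, ∀ z z' : ℤ, z < z' → (z' ≤ z + (2 * g - 2) ∨ z' = z + 1) → U i z → ¬ U i z'

/-- The `r + 1` beads of the family `lam` climb, one at each time, from the levels `r - t - k` to
the levels `r - k`, staying distinct. -/
structure IsTableau (g r t : ℕ) (U : ℕ → ℤ → Prop) (lam : ℕ → ℕ → ℤ) : Prop where
  card : (r + 1) * t = g
  start : ∀ k ≤ r, lam 0 k = r - t - k
  finish : ∀ k ≤ r, lam g k = r - k
  anti : ∀ i ≤ g, ∀ k k', k < k' → k' ≤ r → lam i k' < lam i k
  step : ∀ i < g, ∃ k ≤ r, U i (lam i k) ∧ lam (i + 1) k = lam i k + 1 ∧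
    ∀ k' ≤ r, k' ≠ k → lam (i + 1) k' = lam i k'

theorem Sparse.eq {g : ℕ} (hU : Sparse g U) {i : ℕ} (hi : i < g) {z z' : ℤ} (hz : U i z)
    (hz' : U i z') (h : z ≤ z' + (2 * g - 2) ∨ z = z' + 1)
    (h' : z' ≤ z + (2 * g - 2) ∨ z' = z + 1) :
    z = z' := by
  rcases lt_trichotomy z z' with hlt | heq | hlt
  · exact absurd hz' (hU i hi z z' hlt h' hz)
  · exact heq
  · exact absurd hz (hU i hi z' z hlt h hz')

/-- By `hfin` the first `r + 1` beads rise by at least `(r + 1) * t = g` levels in total. Sparseness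
lets at most one of them climb at each of the `g` times, so all these inequalities are equalities.
-/
theorem isTableau_bead {g r t : ℕ} (hg : 0 < g) (card : (r + 1) * t = g) (hs : s = r - t)
    (hU : Sparse g U) (hfin : ∀ k ≤ r, (r : ℤ) - k ≤ bead s U g k) :
    IsTableau g r t U (bead s U) := by
  have ht : 0 < t := by
    rcases Nat.eq_zero_or_pos t with rfl | h
    · omega
    · exact h
  have hrg : r + 1 ≤ g := by rw [← card]; exact Nat.le_mul_of_pos_right _ ht
  have huniq : ∀ i < g, ∀ k ≤ r, ∀ k' ≤ r, U i (bead s U i k) → U i (bead s U i k') → k = k' := by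
    intro i hi k hk k' hk' h h'
    -- At time `i < g` two of these beads differ by at most `i + r ≤ 2 * g - 2` levels, within the
    -- range controlled by `Sparse`.
    refine (bead_strictAnti (s := s) (U := U) i).injective (hU.eq hi h h' ?_ ?_) <;>
    · left
      have := bead_le (s := s) (U := U) i k
      have := bead_le (s := s) (U := U) i k'
      have := le_bead (s := s) (U := U) i k
      have := le_bead (s := s) (U := U) i k'
      omega
  have hone : ∀ i < g, ∑ k ∈ Finset.range (r + 1), bead s U (i + 1) k ≤
      (∑ k ∈ Finset.range (r + 1), bead s U i k) + 1 := by
    intro i hi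
    by_cases h : ∃ k ≤ r, U i (bead s U i k)
    · obtain ⟨k, hk, hk'⟩ := h
      have hmem : k ∈ Finset.range (r + 1) := Finset.mem_range.2 (by omega)
      rw [← Finset.add_sum_erase _ _ hmem, ← Finset.add_sum_erase _ (bead s U i) hmem]
      have : ∑ l ∈ (Finset.range (r + 1)).erase k, bead s U (i + 1) l =
          ∑ l ∈ (Finset.range (r + 1)).erase k, bead s U i l := by
        refine Finset.sum_congr rfl fun l hl => ?_
        rw [Finset.mem_erase, Finset.mem_range] at hl
        rw [bead, if_neg]
        rintro ⟨h1, -⟩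
        exact hl.1 (huniq i hi l (by omega) k hk h1 hk')
      have := bead_succ_le (s := s) (U := U) i k
      omega
    · push Not at h
      refine (Finset.sum_le_sum fun k hk => ?_).trans (lt_add_one _).le
      rw [bead, if_neg]
      exact fun h' => h k (by have := Finset.mem_range.1 hk; omega) h'.1
  have hsum : ∀ j i, i + j ≤ g → ∑ k ∈ Finset.range (r + 1), bead s U (i + j) k ≤
      (∑ k ∈ Finset.range (r + 1), bead s U i k) + j := by
    intro j i
    induction j with
    | zero => simp
    | succ j ih =>
      intro hj
      have h1 := ih (by omega)
      have h2 := hone (i + j) (by omega)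
      rw [← add_assoc]
      push_cast
      omega
  have hstart : ∑ k ∈ Finset.range (r + 1), bead s U 0 k + g =
      ∑ k ∈ Finset.range (r + 1), ((r : ℤ) - k) := by
    have : ∀ k ∈ Finset.range (r + 1), (r : ℤ) - k = bead s U 0 k + t := by
      intro k _; simp only [bead]; omega
    rw [Finset.sum_congr rfl this, Finset.sum_add_distrib, ← card]
    simp
  have hfin' : ∑ k ∈ Finset.range (r + 1), ((r : ℤ) - k) ≤
      ∑ k ∈ Finset.range (r + 1), bead s U g k :=
    Finset.sum_le_sum fun k hk => hfin k (by have := Finset.mem_range.1 hk; omega)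
  refine ⟨card, fun k hk => ?_, ?_, fun i _ k k' h _ => bead_strictAnti i h, fun i hi => ?_⟩
  · simp only [bead]; omega
  · have h0 := hsum g 0 (by omega)
    rw [zero_add] at h0
    have heq := (Finset.sum_eq_sum_iff_of_le (s := Finset.range (r + 1))
      (f := fun k : ℕ => (r : ℤ) - k) (g := bead s U g)
      fun k hk => hfin k (by have := Finset.mem_range.1 hk; omega)).1 (by omega)
    exact fun k hk => (heq k (Finset.mem_range.2 (by omega))).symm
  · have h1 := hsum i 0 (by omega)
    have h2 := hsum (g - (i + 1)) (i + 1) (by omega)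
    rw [zero_add] at h1
    rw [show i + 1 + (g - (i + 1)) = g by omega] at h2
    have h3 : ∑ k ∈ Finset.range (r + 1), bead s U i k <
        ∑ k ∈ Finset.range (r + 1), bead s U (i + 1) k := by omega
    obtain ⟨k, hk, hlt⟩ := Finset.exists_lt_of_sum_lt h3
    have hk : k ≤ r := by have := Finset.mem_range.1 hk; omega
    have hcl : U i (bead s U i k) ∧ ∀ k' < k, bead s U i k' ≠ bead s U i k + 1 := by
      by_contra hc
      rw [bead, if_neg hc] at hlt
      exact lt_irrefl _ hlt
    refine ⟨k, hk, hcl.1, by rw [bead, if_pos hcl], fun k' hk' hne => ?_⟩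
    rw [bead, if_neg]
    exact fun h => hne (huniq i hi k' hk' k hk h.1 hcl.1)

/-! ### Rigidity of tableaux -/

namespace IsTableau

variable {g r t : ℕ} {lam : ℕ → ℕ → ℤ}

theorem le_succ (T : IsTableau g r t U lam) {i k : ℕ} (hi : i < g) (hk : k ≤ r) :
    lam i k ≤ lam (i + 1) k := by
  obtain ⟨k', -, -, h1, h2⟩ := T.step i hi
  by_cases h : k = k'
  · subst h; omega
  · rw [h2 k hk h]

theorem succ_le (T : IsTableau g r t U lam) {i k : ℕ} (hi : i < g) (hk : k ≤ r) :
    lam (i + 1) k ≤ lam i k + 1 := by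
  obtain ⟨k', -, -, h1, h2⟩ := T.step i hi
  by_cases h : k = k'
  · subst h; omega
  · rw [h2 k hk h]; omega

theorem mono (T : IsTableau g r t U lam) {i j k : ℕ} (hij : i ≤ j) (hj : j ≤ g) (hk : k ≤ r) :
    lam i k ≤ lam j k := by
  induction j, hij using Nat.le_induction with
  | base => rfl
  | succ j hij ih => exact (ih (by omega)).trans (T.le_succ (by omega) hk)

theorem lower (T : IsTableau g r t U lam) {i k : ℕ} (hi : i ≤ g) (hk : k ≤ r) :
    (r : ℤ) - t - k ≤ lam i k := by
  rw [← T.start k hk]; exact T.mono (Nat.zero_le i) hi hk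

theorem upper (T : IsTableau g r t U lam) {i k : ℕ} (hi : i ≤ g) (hk : k ≤ r) :
    lam i k ≤ r - k := by
  rw [← T.finish k hk]; exact T.mono hi le_rfl hk

/-- The difference `(r + 1) * t - (r + t)` is `r * (t - 1)`. The bound makes the window of levels
from `-t` to `r` narrow enough for `Sparse`. -/
theorem add_le (T : IsTableau g r t U lam) (hg : 0 < g) : r + t ≤ g := by
  have := T.card
  rcases Nat.eq_zero_or_pos t with rfl | h
  · omega
  · nlinarith

/-- The level that climbs at time `i` is the only one in the window where climbing is possible. -/
theorem climb_unique (T : IsTableau g r t U lam) (hU : Sparse g U) {i k : ℕ} (hi : i < g)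
    (hk : k ≤ r) (hc : lam (i + 1) k = lam i k + 1) (hUk : U i (lam i k)) {z : ℤ} (hz : U i z)
    (h1 : -(t : ℤ) - 1 ≤ z) (h2 : z ≤ r) : z = lam i k := by
  have h4 := T.lower hi.le hk
  have h5 : lam (i + 1) k ≤ r - k := T.upper hi hk
  have h6 := T.add_le (by omega)
  -- The two levels differ by at most `r + t ≤ g`, which is at most `2 * g - 2` unless `g = 1`. In
  -- that case they are at most adjacent, and the clause on neighbouring levels in `Sparse` decides.
  refine hU.eq hi hz hUk ?_ ?_ <;> omega

/-- A bead of the tableau that may climb does climb. -/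
theorem climbs (T : IsTableau g r t U lam) (hU : Sparse g U) {i k : ℕ} (hi : i < g) (hk : k ≤ r)
    (hUk : U i (lam i k)) : lam (i + 1) k = lam i k + 1 := by
  obtain ⟨k', hk', h1, h2, h3⟩ := T.step i hi
  have h4 := T.lower hi.le hk
  have h5 := T.upper hi.le hk
  have h := T.climb_unique hU hi hk' h2 h1 hUk (by omega) (by omega)
  rcases lt_trichotomy k k' with hlt | rfl | hlt
  · have := T.anti i hi.le k k' hlt hk'; omega
  · exact h2
  · have := T.anti i hi.le k' k hlt hk; omega

/-- A path from the initial to the final level of a bead follows this bead. -/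
theorem path_eq (T : IsTableau g r t U lam) (hU : Sparse g U) {j : ℕ} (hj : j ≤ r) {x : ℕ → ℤ}
    (hx : IsPath (r - t - j) U 0 g x) (hfin : (r : ℤ) - j ≤ x g) {i : ℕ} (hi : i ≤ g) :
    x i = lam i j := by
  have hstart := hx.start
  have hstep := hx.step
  have hstep' := hx.step'
  simp only [Pi.zero_apply, Nat.cast_zero, add_zero] at hstart hstep hstep'
  -- The path cannot overtake the bead: at a common level where the path may climb, the bead climbs
  -- too.
  have hup : ∀ i ≤ g, x i ≤ lam i j := by
    intro i
    induction i with
    | zero => intro _; rw [T.start j hj]; exact hstart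
    | succ i ih =>
      intro hi
      have h1 := ih (by omega)
      have h2 := hstep i hi
      have h3 := T.le_succ hi hj
      rcases h1.lt_or_eq with h1 | h1
      · omega
      · by_cases hu : U i (x i)
        · rw [h1] at hu
          have := T.climbs hU hi hj hu
          omega
        · have := hstep' i hi hu
          omega
  -- A path that has fallen behind never catches up. To do so it would have to climb from the level
  -- of another bead `k`, which climbs at the same time and would land on bead `j`.
  have hlt : ∀ i < g, x i < lam i j → x (i + 1) < lam (i + 1) j := by
    intro i hi h1
    have h2 := hstep i hi
    have h3 := T.le_succ hi hj
    by_cases hu : U i (x i)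
    · by_contra hcon
      obtain ⟨k, hk, hk1, hk2, hk3⟩ := T.step i hi
      have h4 := T.lower hi.le hj
      have h5 := T.upper hi.le hj
      have h6 := T.climb_unique hU hi hk hk2 hk1 hu (by omega) (by omega)
      rcases lt_trichotomy j k with hjk | rfl | hjk
      · have := T.anti (i + 1) hi j k hjk hk
        have := hk3 j hj hjk.ne
        omega
      · omega
      · have := T.anti (i + 1) hi k j hjk hj
        have := hk3 j hj hjk.ne'
        omega
    · have := hstep' i hi hu
      omega
  by_contra hne
  have h0 : x i < lam i j := lt_of_le_of_ne (hup i hi) hne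
  have : ∀ n, i ≤ n → n ≤ g → x n < lam n j := by
    intro n hn
    induction n, hn using Nat.le_induction with
    | base => exact fun _ => h0
    | succ n hn ih => exact fun h => hlt n h (ih (by omega))
  have h1 := this g hi le_rfl
  rw [T.finish j hj] at h1
  omega

end IsTableau

/-! ### The complementary tableau -/

open Classical in
/-- The level of the `k`th hole at time `i`. -/
def hole (s : ℤ) (U : ℕ → ℤ → Prop) : ℕ → ℕ → ℤ
  | 0, k => s + 1 + k
  | i + 1, k => if U i (hole s U i k - 1) then hole s U i k - 1 else hole s U i k

namespace IsTableau

variable {g r t : ℕ} {lam : ℕ → ℕ → ℤ}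

/-- At every time, the beads and the holes partition the window of levels from `-t` to `r`. -/
structure Complementary (r t : ℕ) (beads holes : ℕ → ℤ) : Prop where
  mono : ∀ k k', k < k' → k' < t → holes k < holes k'
  lower : ∀ k < t, -(t : ℤ) ≤ holes k
  upper : ∀ k < t, holes k ≤ r
  disjoint : ∀ j ≤ r, ∀ k < t, beads j ≠ holes k
  cover : ∀ z : ℤ, -(t : ℤ) ≤ z → z ≤ r → (∃ j ≤ r, beads j = z) ∨ ∃ k < t, holes k = z

theorem complementary_zero (T : IsTableau g r t U lam) :
    Complementary r t (lam 0) (hole (r - t) U 0) where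
  mono k k' h _ := by simp only [hole]; omega
  lower k _ := by simp only [hole]; omega
  upper k _ := by simp only [hole]; omega
  disjoint j hj k _ := by rw [T.start j hj]; simp only [hole]; omega
  cover z h1 h2 := by
    rcases le_or_gt z (r - t) with h | h
    · exact Or.inl ⟨(r - t - z).toNat, by omega, by rw [T.start _ (by omega)]; omega⟩
    · exact Or.inr ⟨(z - (r - t) - 1).toNat, by omega, by simp only [hole]; omega⟩

/-- If bead `j` climbs at time `i`, it exchanges its place with a hole. -/
theorem Complementary.exchange (T : IsTableau g r t U lam) (hU : Sparse g U) {i : ℕ} (hi : i < g)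
    (hc : Complementary r t (lam i) (hole (r - t) U i)) :
    ∃ j ≤ r, ∃ k < t, U i (lam i j) ∧ lam (i + 1) j = lam i j + 1 ∧
      (∀ j' ≤ r, j' ≠ j → lam (i + 1) j' = lam i j') ∧
      hole (r - t) U i k = lam i j + 1 ∧ hole (r - t) U (i + 1) k = lam i j ∧
      ∀ k' < t, k' ≠ k → ¬ U i (hole (r - t) U i k' - 1) ∧
        hole (r - t) U (i + 1) k' = hole (r - t) U i k' := by
  obtain ⟨j, hj, hUj, hj1, hj2⟩ := T.step i hi
  have h1 := T.lower hi.le hj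
  have h2 : lam (i + 1) j ≤ r - j := T.upper hi hj
  -- The level above the climbing bead lies in the window and is free of beads, as they stay
  -- distinct; hence it is a hole.
  obtain ⟨k, hk, hkj⟩ : ∃ k < t, hole (r - t) U i k = lam i j + 1 := by
    rcases hc.cover (lam i j + 1) (by omega) (by omega) with ⟨j', hj', h⟩ | h
    · exfalso
      have hne : j' ≠ j := by rintro rfl; omega
      have h3 := hj2 j' hj' hne
      rcases lt_or_gt_of_ne hne with hlt | hlt
      · have := T.anti (i + 1) hi j' j hlt hj; omega
      · have := T.anti (i + 1) hi j j' hlt hj'; omega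
    · exact h
  refine ⟨j, hj, k, hk, hUj, hj1, hj2, hkj, ?_, fun k' hk' hne => ?_⟩
  · rw [hole, if_pos (by rw [hkj]; simpa using hUj), hkj]; ring
  · have hn : ¬ U i (hole (r - t) U i k' - 1) := by
      intro hu
      have h3 := hc.lower k' hk'
      have h4 := hc.upper k' hk'
      have h5 := T.climb_unique hU hi hj hj1 hUj hu (by omega) (by omega)
      rcases lt_or_gt_of_ne hne with hlt | hlt
      · have := hc.mono k' k hlt hk; omega
      · have := hc.mono k k' hlt hk'; omega
    exact ⟨hn, by rw [hole, if_neg hn]⟩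

/-- Each step swaps one bead with the hole directly above it, which preserves the partition and the
order of the holes. -/
theorem complementary (T : IsTableau g r t U lam) (hU : Sparse g U) {i : ℕ} (hi : i ≤ g) :
    Complementary r t (lam i) (hole (r - t) U i) := by
  induction i with
  | zero => exact T.complementary_zero
  | succ i ih =>
    have hc := ih (by omega)
    obtain ⟨j, hj, k, hk, hUj, hj1, hj2, hkj, hkj', hk2⟩ := hc.exchange T hU hi
    have h1 := T.lower (i := i) (by omega) hj
    have hpos : ∀ k' < t, k' = k ∨ hole (r - t) U (i + 1) k' = hole (r - t) U i k' := by
      intro k' hk'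
      by_cases h : k' = k
      · exact Or.inl h
      · exact Or.inr (hk2 k' hk' h).2
    have hposj : ∀ j' ≤ r, j' = j ∨ lam (i + 1) j' = lam i j' := by
      intro j' hj'
      by_cases h : j' = j
      · exact Or.inl h
      · exact Or.inr (hj2 j' hj' h)
    refine ⟨fun a b hab hb => ?_, fun a ha => ?_, fun a ha => ?_, fun a ha b hb => ?_,
      fun z hz1 hz2 => ?_⟩
    · have h0 := hc.mono a b hab hb
      have h2 := hc.disjoint j hj a (by omega)
      rcases hpos a (by omega) with rfl | ha <;> rcases hpos b hb with rfl | hb <;> omega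
    · have h0 := hc.lower a ha
      rcases hpos a ha with rfl | ha <;> omega
    · have h0 := hc.upper a ha
      rcases hpos a ha with rfl | ha <;> omega
    · have h0 := hc.disjoint a ha b hb
      rcases hpos b hb with rfl | hb'
      · rcases hposj a ha with rfl | ha'
        · omega
        · rw [hkj', ha']
          have hne : a ≠ j := by rintro rfl; omega
          rcases lt_or_gt_of_ne hne with hlt | hlt
          · have := T.anti i (by omega) a j hlt hj; omega
          · have := T.anti i (by omega) j a hlt ha; omega
      · rcases hposj a ha with rfl | ha'
        · rw [hj1, hb']
          intro h
          have hne : b ≠ k := by rintro rfl; omega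
          rcases lt_or_gt_of_ne hne with hlt | hlt
          · have := hc.mono b k hlt hk; omega
          · have := hc.mono k b hlt hb; omega
        · omega
    · by_cases e1 : z = lam i j
      · exact Or.inr ⟨k, hk, by omega⟩
      by_cases e2 : z = lam i j + 1
      · exact Or.inl ⟨j, hj, by omega⟩
      rcases hc.cover z hz1 hz2 with ⟨a, ha, h⟩ | ⟨a, ha, h⟩
      · refine Or.inl ⟨a, ha, ?_⟩
        rcases hposj a ha with rfl | ha' <;> omega
      · refine Or.inr ⟨a, ha, ?_⟩
        rcases hpos a ha with rfl | ha' <;> omega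

/-- Finally the beads fill the levels from `0` to `r`, so the `t` increasing holes have to fill
those from `-t` to `-1`. -/
theorem hole_finish (T : IsTableau g r t U lam) (hU : Sparse g U) {k : ℕ} (hk : k < t) :
    hole (r - t) U g k = -t + k := by
  have hc := T.complementary hU le_rfl
  have hneg : ∀ k < t, hole (r - t) U g k < 0 := by
    intro k hk
    by_contra h
    have h1 := hc.upper k hk
    have h2 := hc.disjoint (r - hole (r - t) U g k).toNat (by omega) k hk
    rw [T.finish _ (by omega)] at h2
    omega
  have hlow : ∀ k < t, -(t : ℤ) + k ≤ hole (r - t) U g k := by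
    intro k
    induction k with
    | zero => intro hk; have := hc.lower 0 hk; simpa using this
    | succ k ih =>
      intro hk
      have := ih (by omega)
      have := hc.mono k (k + 1) (by omega) hk
      push_cast; omega
  have hup : ∀ n < t, hole (r - t) U g (t - 1 - n) < -n := by
    intro n
    induction n with
    | zero => intro hn; simpa using hneg (t - 1 - 0) (by omega)
    | succ n ih =>
      intro hn
      have := ih (by omega)
      have := hc.mono (t - 1 - (n + 1)) (t - 1 - n) (by omega) (by omega)
      push_cast; omega
  have h1 := hlow k hk
  have h2 := hup (t - 1 - k) (by omega)
  rw [show t - 1 - (t - 1 - k) = k by omega] at h2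
  omega

/-- The levels of the holes, read upside down, form a tableau. -/
theorem dual (T : IsTableau g r t U lam) (hU : Sparse g U) (ht : 0 < t) :
    IsTableau g (t - 1) (r + 1) (fun i z => U i (-z - 2)) fun i k => -hole (r - t) U i k - 1 where
  card := by rw [← T.card, Nat.sub_add_cancel ht, mul_comm]
  start k hk := by simp only [hole]; push_cast [ht]; ring
  finish k hk := by rw [T.hole_finish hU (by omega)]; push_cast [ht]; ring
  anti i hi k k' h hk := by
    have := (T.complementary hU hi).mono k k' h (by omega)
    omega
  step i hi := by
    obtain ⟨j, hj, k, hk, hUj, -, -, h1, h2, h3⟩ := (T.complementary hU hi.le).exchange T hU hi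
    refine ⟨k, by omega, ?_, by omega, fun k' hk' hne => ?_⟩
    · rw [h1]; convert hUj using 1; ring
    · rw [(h3 k' (by omega) hne).2]

end IsTableau

theorem Sparse.dual {g : ℕ} (hU : Sparse g U) : Sparse g fun i z => U i (-z - 2) :=
  fun i hi z z' h h' hz hz' => hU i hi (-z' - 2) (-z - 2) (by omega) (by omega) hz' hz

end Beads

theorem Fin.sum_ite_lt {M : Type*} [AddCommMonoid M] {g i : ℕ} (hi : i ≤ g) (a : ℕ → M) :
    ∑ l : Fin g, (if l.1 < i then a l else 0) = ∑ l ∈ Finset.range i, a l := by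
  rw [Fin.sum_univ_eq_sum_range (fun l => if l < i then a l else 0) g, ← Finset.sum_filter]
  congr 1
  ext l
  simp only [Finset.mem_filter, Finset.mem_range]
  omega

namespace ChainOfLoops

open MetricGraph

variable {g : ℕ} {C : ChainOfLoops g}

theorem degree_sub (D D' : C.graph.Divisor) : degree (D - D') = degree D - degree D' := by
  simp only [degree_eq_weigh, map_sub]

theorem degree_add (D D' : C.graph.Divisor) : degree (D + D') = degree D + degree D' := by
  simp only [degree_eq_weigh, map_add]

theorem degree_single (p : C.graph.Point) (a : ℤ) : degree (Finsupp.single p a) = a := by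
  simp [degree_eq_weigh]

/-! ### Effective divisors, loop by loop -/

theorem degBefore_succ (c : ℕ) (Z : C.graph.Divisor) :
    C.degBefore (c + 1) Z =
      C.degBefore c Z + weigh (fun p => if C.pos p = c then (1 : ℤ) else 0) Z := by
  induction Z using Finsupp.induction_linear with
  | zero => simp
  | add f h hf hh => simp only [map_add, hf, hh]; ring
  | single p a =>
    simp only [degBefore_single, weigh_single, smul_eq_mul, mul_ite, mul_one, mul_zero]
    split_ifs <;> omega

theorem degBefore_le_succ {Z : C.graph.Divisor} (hZ : 0 ≤ Z) (c : ℕ) :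
    C.degBefore c Z ≤ C.degBefore (c + 1) Z := by
  rw [degBefore_succ]
  have : 0 ≤ weigh (fun p => if C.pos p = c then (1 : ℤ) else 0) Z :=
    weigh_nonneg (fun p => by split_ifs <;> omega) fun p _ => hZ p
  omega

theorem eq_zero_of_degBefore {Z : C.graph.Divisor} (hZ : 0 ≤ Z) {c : ℕ}
    (h : C.degBefore (c + 1) Z = C.degBefore c Z) {p : C.graph.Point} (hp : C.pos p = c) :
    Z p = 0 := by
  rw [degBefore_succ, add_eq_left, weigh_apply, Finset.sum_eq_zero_iff_of_nonneg] at h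
  · by_contra hne
    have := h p (Finsupp.mem_support_iff.2 hne)
    simp [hp] at this
    exact hne this
  · intro q _
    have := hZ q
    simp only [Finsupp.coe_zero, Pi.zero_apply] at this
    simp only [smul_eq_mul]
    split_ifs <;> omega

theorem exists_single_of_degBefore {Z : C.graph.Divisor} (hZ : 0 ≤ Z) {c : ℕ}
    (h : C.degBefore (c + 1) Z = C.degBefore c Z + 1) :
    ∃ q, C.pos q = c ∧ ∀ p, C.pos p = c → (Z - Finsupp.single q 1 : C.graph.Divisor) p = 0 := by
  classical
  have hq : ∃ q, C.pos q = c ∧ Z q ≠ 0 := by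
    by_contra! hcon
    have : weigh (fun p => if C.pos p = c then (1 : ℤ) else 0) Z = weigh (fun _ => (0 : ℤ)) Z :=
      weigh_congr fun p hp => if_neg fun hpc => hp (hcon p hpc)
    rw [degBefore_succ, this, weigh_apply] at h
    simp at h
  obtain ⟨q, hq, hq0⟩ := hq
  refine ⟨q, hq, fun p hp => eq_zero_of_degBefore (fun p => ?_) ?_ hp⟩
  · have h0 : 0 ≤ Z p := hZ p
    simp only [Finsupp.coe_zero, Pi.zero_apply, Finsupp.sub_apply, Finsupp.single_apply]
    split_ifs with hqp
    · subst hqp; omega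
    · omega
  · simp only [map_sub, degBefore_single, h, hq, lt_add_one, if_true, lt_irrefl, if_false]
    ring

theorem coord_of_pos_lt {i : Fin g} {p : C.graph.Point} (h : C.pos p < 2 * i) :
    C.coord i p = -C.ell i := by
  induction p using point_cases with
  | hL l => rw [coord_vtxL, if_pos]; rw [pos_vtxL] at h; rw [Fin.le_def]; omega
  | hR l => rw [coord_vtxR, if_pos]; rw [pos_vtxR] at h; rw [Fin.lt_def]; omega
  | ht l x h0 h1 => rw [coord_top, if_pos]; rw [pos_top] at h; rw [Fin.lt_def]; omega
  | hb l x h0 h1 => rw [coord_bot, if_pos]; rw [pos_bot] at h; rw [Fin.lt_def]; omega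
  | hbr l x h0 h1 => rw [coord_bri, if_pos]; rw [pos_bri] at h; omega

theorem coord_of_lt_pos {i : Fin g} {p : C.graph.Point} (h : 2 * i < C.pos p) :
    C.coord i p = 0 := by
  induction p using point_cases with
  | hL l => rw [coord_vtxL, if_neg]; rw [pos_vtxL] at h; rw [Fin.le_def]; omega
  | hR l => rw [coord_vtxR, if_neg]; rw [pos_vtxR] at h; rw [Fin.lt_def]; omega
  | ht l x h0 h1 =>
    rw [pos_top] at h
    rw [coord_top, if_neg (by rw [Fin.lt_def]; omega), if_neg (by rintro rfl; omega)]
  | hb l x h0 h1 =>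
    rw [pos_bot] at h
    rw [coord_bot, if_neg (by rw [Fin.lt_def]; omega), if_neg (by rintro rfl; omega)]
  | hbr l x h0 h1 => rw [coord_bri, if_neg]; rw [pos_bri] at h; omega

/-- Chips to the left retract to the left vertex, at coordinate `-ell i`, and chips to the right
retract to the origin. -/
theorem jac_of_loop_empty {Z : C.graph.Divisor} {i : Fin g}
    (h : ∀ p, C.pos p = 2 * i → Z p = 0) :
    C.jac i Z = (-C.degBefore (2 * i) Z) • (C.ell i : AddCircle (C.ell i + C.m i)) := by
  rw [jac, degBefore, weigh_apply, weigh_apply, ← Finset.sum_neg_distrib, Finset.sum_smul]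
  refine Finset.sum_congr rfl fun p hp => ?_
  have hne : C.pos p ≠ 2 * i := fun h' => Finsupp.mem_support_iff.1 hp (h p h')
  rcases lt_or_gt_of_ne hne with hlt | hlt
  · rw [coord_of_pos_lt hlt, if_pos hlt]
    simp
  · rw [coord_of_lt_pos hlt, if_neg hlt.not_gt]
    simp

theorem jac_of_loop_single {Z : C.graph.Divisor} {i : Fin g} {q : C.graph.Point}
    (hq : C.pos q = 2 * i)
    (h : ∀ p, C.pos p = 2 * i → (Z - Finsupp.single q 1 : C.graph.Divisor) p = 0) :
    C.jac i Z = (C.coord i q : AddCircle (C.ell i + C.m i)) -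
      C.degBefore (2 * i) Z • (C.ell i : AddCircle (C.ell i + C.m i)) := by
  have := jac_of_loop_empty h
  rw [map_sub, map_sub, jac_single, degBefore_single, hq, if_neg (lt_irrefl _), sub_zero,
    one_zsmul, neg_zsmul, sub_eq_iff_eq_add] at this
  rw [this]; abel

/-! ### Levels of effective divisors -/

/-- At the `i`th loop a bead at level `z` may climb. -/
def Climb (D : C.graph.Divisor) (i : ℕ) (z : ℤ) : Prop :=
  ∃ h : i < g, C.jac ⟨i, h⟩ D = (-(degree D - g + i - z)) •
    (C.ell ⟨i, h⟩ : AddCircle (C.ell ⟨i, h⟩ + C.m ⟨i, h⟩))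

/-- If two levels differing by `N` both allow a climb, `N * ell` is an integer multiple of `ell +
m`. Hence `ell / m` is a ratio of two positive integers with sum `N`, which genericity excludes for
`N ≤ 2 * g - 2`; for `N = 1` no such integers exist. -/
theorem sparse_climb (hC : C.Generic) (D : C.graph.Divisor) : Sparse g (Climb D) := by
  rintro i hi z z' hlt hbd ⟨h₁, hz⟩ ⟨h₂, hz'⟩
  rw [hz, ← sub_eq_zero, ← sub_smul, ← AddCircle.coe_zsmul, AddCircle.coe_eq_zero_iff] at hz'
  obtain ⟨n, hn⟩ := hz'
  set ℓ := C.ell ⟨i, hi⟩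
  set m := C.m ⟨i, hi⟩
  have hl : 0 < ℓ := C.ell_pos _
  have hm : 0 < m := C.m_pos _
  obtain ⟨N, hN⟩ : ∃ N : ℤ, N = z' - z := ⟨_, rfl⟩
  have hn' : (n : ℝ) * (ℓ + m) = -N * ℓ := by
    rw [zsmul_eq_mul, zsmul_eq_mul] at hn
    rw [hn, hN]; push_cast; ring
  have hNpos : (0 : ℝ) < N := by exact_mod_cast (by omega : 0 < N)
  have hnneg : (n : ℝ) < 0 := by
    by_contra hcon
    push Not at hcon
    have : 0 ≤ (n : ℝ) * (ℓ + m) := by positivity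
    have : 0 < (N : ℝ) * ℓ := by positivity
    linarith
  have hsum : (0 : ℝ) < N + n := by
    have : (N + n : ℝ) * ℓ = -n * m := by linarith
    have h2 : 0 < (-n : ℝ) * m := mul_pos (by linarith) hm
    rw [← this] at h2
    exact pos_of_mul_pos_left h2 hl.le
  have hnneg' : n < 0 := by exact_mod_cast hnneg
  have hsum' : 0 < N + n := by exact_mod_cast hsum
  rcases hbd with hbd | hbd
  · refine hC ⟨i, hi⟩ (-n).toNat (N + n).toNat (by omega) (by omega) (by omega) ?_
    have e1 : (((-n).toNat : ℕ) : ℝ) = -n := by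
      have : (((-n).toNat : ℕ) : ℤ) = -n := by omega
      exact_mod_cast this
    have e2 : (((N + n).toNat : ℕ) : ℝ) = N + n := by
      have : (((N + n).toNat : ℕ) : ℤ) = N + n := by omega
      exact_mod_cast this
    rw [e1, e2, div_eq_div_iff hm.ne' hsum.ne']
    linarith
  · omega

/-- This is the source of the formula in `Climb`: an empty loop leaves `jac i` to the chips on its
left, which fixes `jac i D` in terms of the current level. -/
theorem climb_of_loop_empty {D D'' : C.graph.Divisor} (hD'' : 0 ≤ D'') {i : Fin g} {k : ℤ}
    (hk : C.jac i D'' = C.jac i D + k • (C.ell i : AddCircle (C.ell i + C.m i)))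
    (h : C.degBefore (2 * i + 1) D'' = C.degBefore (2 * i) D'') :
    Climb D i (degree D - g + i - C.degBefore (2 * i) D'' - k) := by
  refine ⟨i.2, ?_⟩
  rw [jac_of_loop_empty fun p hp => eq_zero_of_degBefore hD'' h hp] at hk
  change C.jac i D = _ • (C.ell i : AddCircle (C.ell i + C.m i))
  rw [← sub_eq_iff_eq_add, ← sub_smul] at hk
  rw [← hk]
  congr 1
  ring

/-- Here `k i` counts the chips removed before time `i`. From `i` to `i + 1` the level gains one,
minus the chips on the loop and the following bridge and the `F (i + 1)` chips removed. A gain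
before this removal requires an empty loop. -/
theorem isPath_of_effective {D D'' : C.graph.Divisor} (hD'' : 0 ≤ D'') {s : ℤ} {F : ℕ → ℕ}
    {k : ℕ → ℤ} (hk : ∀ i : Fin g,
      C.jac i D'' = C.jac i D + k i • (C.ell i : AddCircle (C.ell i + C.m i)))
    (hs : degree D - g - k 0 + F 0 ≤ s) (hF : ∀ i, k (i + 1) = k i + F (i + 1)) :
    IsPath s (Climb D) F g fun i => degree D - g + i - C.degBefore (2 * i) D'' - k i := by
  refine ⟨by simpa using hs, fun i hi => ?_, fun i hi hn => ?_⟩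
  · have h1 := degBefore_le_succ hD'' (2 * i)
    have h2 := degBefore_le_succ hD'' (2 * i + 1)
    rw [hF, show 2 * (i + 1) = 2 * i + 1 + 1 by ring]
    push_cast
    omega
  · have h1 := degBefore_le_succ hD'' (2 * i)
    have h2 := degBefore_le_succ hD'' (2 * i + 1)
    have h3 : C.degBefore (2 * i + 1) D'' ≠ C.degBefore (2 * i) D'' :=
      fun h => hn (climb_of_loop_empty (i := ⟨i, hi⟩) hD'' (hk ⟨i, hi⟩) h)
    rw [hF, show 2 * (i + 1) = 2 * i + 1 + 1 by ring]
    push_cast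
    omega

/-! ### Divisors of rank at least `r` -/

/-- A divisor of rank at least `r` and Brill-Noether number zero gives a tableau. -/
theorem isTableau_of_rankAtLeast (hg : 0 < g) (hC : C.Generic) {r t : ℕ} {D : C.graph.Divisor}
    (card : (r + 1) * t = g) (hdeg : degree D = g + r - t) (hrank : RankAtLeast D r) :
    IsTableau g r t (Climb D) (bead (r - t) (Climb D)) := by
  have hU := sparse_climb hC D
  refine isTableau_bead hg card rfl hU fun k hk => ?_
  obtain ⟨F₀, hF0, hFs, hF⟩ := exists_forcing (s := r - t) g k
    fun i hi z hz => hU i hi z (z + 1) (by omega) (Or.inr rfl) hz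
  let v : C.graph.Point := C.vtxL ⟨0, hg⟩
  -- The `r - k` chips not needed for forcing are added at the right end, where they lower only the
  -- final level.
  let F : ℕ → ℕ := fun i => if i = g then F₀ g + (r - k) else F₀ i
  have hFlt : ∀ i < g, F i = F₀ i := fun i hi => if_neg hi.ne
  have hFg : F g = F₀ g + (r - k) := if_pos rfl
  -- Chips for time `0` go to the left end, those for time `l + 1` to the right vertex of loop `l`.
  let Φ : C.graph.Divisor := Finsupp.single v (F 0 : ℤ) +
    ∑ l : Fin g, Finsupp.single (C.vtxR l) (F (l + 1) : ℤ)
  have hsum : ∑ i ∈ Finset.range (g + 1), F i = r := by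
    rw [Finset.sum_range_succ, hFg, Finset.sum_congr rfl
      (fun i hi => hFlt i (Finset.mem_range.1 hi))]
    rw [Finset.sum_range_succ] at hFs
    change ∑ i ∈ Finset.range g, F₀ i + _ = _
    omega
  have hΦ : 0 ≤ Φ := add_nonneg (Finsupp.single_nonneg.2 (by positivity))
    (Finset.sum_nonneg fun l _ => Finsupp.single_nonneg.2 (by positivity))
  have hdΦ : degree Φ = r := by
    rw [← hsum, Finset.sum_range_succ', degree_eq_weigh]
    simp only [Φ, map_add, map_sum, weigh_single, smul_eq_mul, mul_one]
    rw [Fin.sum_univ_eq_sum_range (fun l => (F (l + 1) : ℤ)) g]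
    push_cast; ring
  let k' : ℕ → ℤ := fun i => ∑ m ∈ Finset.range (i + 1), (F m : ℤ)
  have hjΦ : ∀ i : Fin g, C.jac i Φ = (-k' i) • (C.ell i : AddCircle (C.ell i + C.m i)) := by
    intro i
    simp only [Φ, map_add, map_sum, jac_single, v, coord_vtxL, coord_vtxR, k']
    rw [if_pos (by simp [Fin.le_def]), Finset.sum_range_succ', neg_zsmul, add_zsmul,
      Finset.sum_smul, ← Fin.sum_ite_lt i.2.le
        (fun l => (F (l + 1) : ℤ) • (C.ell i : AddCircle (C.ell i + C.m i))), neg_add,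
      ← Finset.sum_neg_distrib]
    refine (add_comm _ _).trans (congrArg₂ (· + ·) (Finset.sum_congr rfl fun l _ => ?_) (by simp))
    by_cases h : l < i
    · rw [if_pos h, if_pos (Fin.lt_def.1 h)]; simp
    · rw [if_neg h, if_neg (fun h' => h (Fin.lt_def.2 h'))]; simp
  obtain ⟨D'', hD'', heq⟩ := hrank Φ hΦ hdΦ
  have hpath := isPath_of_effective (D := D) (s := r - t) (F := F) (k := k') hD'' (fun i => by
      rw [← jac_eq_of_equivalent heq, map_sub, hjΦ, neg_zsmul, sub_neg_eq_add])
    (by simp [k']; omega) (fun i => by simp only [k']; rw [Finset.sum_range_succ])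
  -- After all `g` loops the level is zero, since the effective divisor has degree `degree D - r`.
  have hxg : degree D - g + g - C.degBefore (2 * g) D'' - k' g = 0 := by
    rw [C.degBefore_eq_degree (by omega), ← degree_eq_of_equivalent heq, degree_sub, hdΦ]
    have : k' g = r := by simp only [k']; exact_mod_cast hsum
    omega
  set x : ℕ → ℤ := fun i => degree D - g + i - C.degBefore (2 * i) D'' - k' i with hx
  have hxg' : x g = 0 := hxg
  -- Giving back the extra `r - k` chips at the end yields a path for `F₀` ending at level `r - k`,
  -- so bead `k` is at least as high.
  have hpath₀ : IsPath (r - t) (Climb D) F₀ g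
      fun i => if i = g then x i + (r - k : ℕ) else x i := by
    refine ⟨?_, fun i hi => ?_, fun i hi hn => ?_⟩
    · have := hpath.start
      rw [hFlt 0 hg] at this
      rwa [if_neg hg.ne]
    · have := hpath.step i hi
      rw [if_neg hi.ne]
      split_ifs with h
      · rw [h, hFg] at this; rw [h]; push_cast at this ⊢; omega
      · rwa [hFlt _ (by omega)] at this
    · rw [if_neg hi.ne] at hn ⊢
      have := hpath.step' i hi hn
      split_ifs with h
      · rw [h, hFg] at this; rw [h]; push_cast at this ⊢; omega
      · rwa [hFlt _ (by omega)] at this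
  have := hF _ hpath₀
  rw [if_pos rfl, hxg'] at this
  omega

end ChainOfLoops

namespace ChainOfLoops

open MetricGraph

variable {g : ℕ} {C : ChainOfLoops g}

/-! ### The distinguished divisors -/

theorem leftEnd_eq (hg : 0 < g) : C.leftEnd hg = C.vtxL ⟨0, hg⟩ := rfl

theorem rightEnd_eq (hg : 0 < g) : C.rightEnd hg = C.vtxR ⟨g - 1, by omega⟩ := rfl

variable (C) in
/-- The divisor `j v + (n - j) w` for the left end `v` and the right end `w` of the chain. -/
def endDivisor (hg : 0 < g) (n j : ℤ) : C.graph.Divisor :=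
  Finsupp.single (C.leftEnd hg) j + Finsupp.single (C.rightEnd hg) (n - j)

theorem degree_endDivisor (hg : 0 < g) (n j : ℤ) : degree (C.endDivisor hg n j) = n := by
  rw [endDivisor, degree_add, degree_single, degree_single]; ring

theorem degBefore_endDivisor (hg : 0 < g) (n j : ℤ) {c : ℕ} (h0 : 0 < c) (hc : c + 2 ≤ 2 * g) :
    C.degBefore c (C.endDivisor hg n j) = j := by
  rw [endDivisor, map_add, degBefore_single, degBefore_single, leftEnd_eq, rightEnd_eq, pos_vtxL,
    pos_vtxR, if_pos (by simpa), if_neg (by simp only; omega), add_zero]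

theorem jac_endDivisor (hg : 0 < g) (n j : ℤ) (i : Fin g) :
    C.jac i (C.endDivisor hg n j) = (-j) • (C.ell i : AddCircle (C.ell i + C.m i)) := by
  have h1 : (⟨0, hg⟩ : Fin g) ≤ i := by simp [Fin.le_def]
  have h2 : ¬ (⟨g - 1, by omega⟩ : Fin g) < i := by
    rw [Fin.lt_def]; have := i.2; simp only; omega
  rw [endDivisor, map_add, jac_single, jac_single, leftEnd_eq, rightEnd_eq, coord_vtxL, coord_vtxR,
    if_pos h1, if_neg h2]
  simp

theorem isDistinguished_iff (hg : 0 < g) {D D' : C.graph.Divisor} {n j : ℤ} :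
    C.IsDistinguished hg D n j D' ↔ Equivalent D D' ∧ 0 ≤ D' - C.endDivisor hg n j := by
  rw [IsDistinguished, endDivisor, sub_sub]

section

variable {hg : 0 < g} {D D' : C.graph.Divisor} {r t : ℕ} {lam : ℕ → ℕ → ℤ}

theorem IsDistinguished.jac_sub {n j : ℤ} (h : C.IsDistinguished hg D n j D') (i : Fin g) :
    C.jac i (D' - C.endDivisor hg n j) =
      C.jac i D + j • (C.ell i : AddCircle (C.ell i + C.m i)) := by
  rw [map_sub, jac_endDivisor, ← jac_eq_of_equivalent h.1, neg_zsmul, sub_neg_eq_add]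

/-- Removing `j` chips at the left end and `r - j` at the right end leaves a level path from `r - t
- j` to `r - j`; by `IsTableau.path_eq` it follows bead `j`. -/
theorem IsDistinguished.degBefore_sub
    (T : IsTableau g r t (Climb D) lam) (hU : Sparse g (Climb D)) (hdeg : degree D = g + r - t)
    {j : ℕ} (hj : j ≤ r) (h : C.IsDistinguished hg D r j D') {i : ℕ} (hi : i ≤ g) :
    C.degBefore (2 * i) (D' - C.endDivisor hg r j) = r - t + i - j - lam i j := by
  have hnn := ((isDistinguished_iff hg).1 h).2
  have hp := isPath_of_effective (D := D) (F := 0) (k := fun _ => (j : ℤ)) (s := r - t - j) hnn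
    h.jac_sub (by simp; omega) (by simp)
  have := T.path_eq hU hj hp (by
    rw [C.degBefore_eq_degree (by omega), degree_sub, degree_endDivisor,
      ← degree_eq_of_equivalent h.1]
    omega) hi
  omega

/-- The part of a distinguished divisor away from the ends has no chips on the bridges. -/
theorem IsDistinguished.degBefore_sub_odd
    (T : IsTableau g r t (Climb D) lam) (hU : Sparse g (Climb D)) (hdeg : degree D = g + r - t)
    {j : ℕ} (hj : j ≤ r) (h : C.IsDistinguished hg D r j D') {i : ℕ} (hi : i < g) :
    C.degBefore (2 * i + 1) (D' - C.endDivisor hg r j) =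
      C.degBefore (2 * (i + 1)) (D' - C.endDivisor hg r j) := by
  have hnn := ((isDistinguished_iff hg).1 h).2
  have h1 := IsDistinguished.degBefore_sub T hU hdeg hj h hi.le
  have h2 := IsDistinguished.degBefore_sub T hU hdeg hj h (i := i + 1) hi
  have h3 := degBefore_le_succ hnn (2 * i)
  have h4 := degBefore_le_succ hnn (2 * i + 1)
  have h5 := T.le_succ hi hj
  rw [show 2 * (i + 1) = 2 * i + 1 + 1 by ring] at h2 ⊢
  push_cast at h2
  -- A loop and the following bridge carry at most one chip together. If it lies on the bridge, the
  -- loop is empty, so bead `j` climbs here, but then there is no chip at all.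
  by_contra hne
  have h6 := climb_of_loop_empty (i := ⟨i, hi⟩) hnn (h.jac_sub ⟨i, hi⟩)
    (by simp only; omega)
  simp only at h6
  rw [h1, hdeg, show (g : ℤ) + r - t - g + i - (r - t + i - j - lam i j) - j = lam i j by ring]
    at h6
  have := T.climbs hU hi hj h6
  omega

/-- Away from the ends' prescribed chips, bridges are empty and each loop carries no chip or exactly
one, according to bead `j`. The position of that chip is determined by `jac i`. -/
theorem IsDistinguished.unique
    (T : IsTableau g r t (Climb D) lam) (hU : Sparse g (Climb D)) (hdeg : degree D = g + r - t)
    {j : ℕ} (hj : j ≤ r) {D₁ D₂ : C.graph.Divisor} (h₁ : C.IsDistinguished hg D r j D₁)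
    (h₂ : C.IsDistinguished hg D r j D₂) : D₁ = D₂ := by
  have hn₁ := ((isDistinguished_iff hg).1 h₁).2
  have hn₂ := ((isDistinguished_iff hg).1 h₂).2
  have he₁ := fun {i : ℕ} (hi : i ≤ g) => IsDistinguished.degBefore_sub T hU hdeg hj h₁ hi
  have he₂ := fun {i : ℕ} (hi : i ≤ g) => IsDistinguished.degBefore_sub T hU hdeg hj h₂ hi
  have ho₁ := fun {i : ℕ} (hi : i < g) => IsDistinguished.degBefore_sub_odd T hU hdeg hj h₁ hi
  have ho₂ := fun {i : ℕ} (hi : i < g) => IsDistinguished.degBefore_sub_odd T hU hdeg hj h₂ hi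
  have hj₁ := h₁.jac_sub
  have hj₂ := h₂.jac_sub
  refine sub_left_injective (b := C.endDivisor hg r j) ?_
  change D₁ - C.endDivisor hg r j = D₂ - C.endDivisor hg r j
  generalize D₁ - C.endDivisor hg r j = Z₁ at *
  generalize D₂ - C.endDivisor hg r j = Z₂ at *
  ext p
  have hlt := C.pos_lt p
  obtain ⟨i, hi | hi⟩ : ∃ i, C.pos p = 2 * i ∨ C.pos p = 2 * i + 1 := ⟨C.pos p / 2, by omega⟩
  · have hig : i < g := by omega
    have a₁ := he₁ hig.le
    have a₂ := he₂ hig.le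
    have b₁ := he₁ (i := i + 1) hig
    have b₂ := he₂ (i := i + 1) hig
    rw [← ho₁ hig] at b₁
    rw [← ho₂ hig] at b₂
    have h5 := T.le_succ hig hj
    have h6 := T.succ_le hig hj
    push_cast at b₁ b₂
    rcases h6.lt_or_eq with h6 | h6
    · obtain ⟨q₁, hq₁, hs₁⟩ := exists_single_of_degBefore hn₁ (c := 2 * i) (by omega)
      obtain ⟨q₂, hq₂, hs₂⟩ := exists_single_of_degBefore hn₂ (c := 2 * i) (by omega)
      have c₁ := jac_of_loop_single (i := ⟨i, hig⟩) hq₁ hs₁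
      have c₂ := jac_of_loop_single (i := ⟨i, hig⟩) hq₂ hs₂
      rw [hj₁] at c₁
      rw [hj₂, c₁] at c₂
      simp only [a₁, a₂] at c₂
      have := eq_of_coord_eq hq₁ hq₂ (sub_left_injective c₂)
      subst this
      have d₁ := hs₁ p hi
      have d₂ := hs₂ p hi
      rw [Finsupp.sub_apply] at d₁ d₂
      omega
    · rw [eq_zero_of_degBefore hn₁ (c := 2 * i) (by omega) hi,
        eq_zero_of_degBefore hn₂ (c := 2 * i) (by omega) hi]
  · have hig : i < g := by omega
    rw [eq_zero_of_degBefore hn₁ (ho₁ hig).symm hi, eq_zero_of_degBefore hn₂ (ho₂ hig).symm hi]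

theorem exists_isDistinguished (hg : 0 < g)
    (T : IsTableau g r t (Climb D) lam) (hdeg : degree D = g + r - t)
    {j : ℕ} (hj : j ≤ r) : ∃ D', C.IsDistinguished hg D r j D' := by
  -- The position a chip on loop `i` must have for `jac i` to come out right. It is used only when
  -- bead `j` stays put, that is, when `ε i = 1`.
  have hp := fun i : Fin g => exists_coord_eq i
    (C.jac i D + (r - t + i - lam i j) • (C.ell i : AddCircle (C.ell i + C.m i)))
  choose p hpos hcoord using hp
  let ε : ℕ → ℤ := fun i => 1 - (lam (i + 1) j - lam i j)
  let Z : C.graph.Divisor := ∑ l : Fin g, Finsupp.single (p l) (ε l)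
  have hε : ∀ i ≤ g, ∑ l ∈ Finset.range i, ε l = r - t + i - j - lam i j := by
    intro i _
    simp only [ε]
    rw [Finset.sum_sub_distrib, Finset.sum_range_sub (fun l => lam l j), T.start j hj]
    simp; ring
  have hZ : 0 ≤ Z := by
    refine Finset.sum_nonneg fun l _ => Finsupp.single_nonneg.2 ?_
    have := T.succ_le l.2 hj
    simp only [ε]; omega
  have hdZ : degree Z = g - t := by
    rw [degree_eq_weigh]
    simp only [Z, map_sum, weigh_single, smul_eq_mul, mul_one]
    rw [Fin.sum_univ_eq_sum_range ε g, hε g le_rfl, T.finish j hj]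
    ring
  have hjZ : ∀ i : Fin g, C.jac i Z =
      C.jac i D + j • (C.ell i : AddCircle (C.ell i + C.m i)) := by
    intro i
    have hterm : ∀ l : Fin g, ε l • (C.coord i (p l) : AddCircle (C.ell i + C.m i)) =
        (if l.1 < i.1 then (-ε l) • (C.ell i : AddCircle (C.ell i + C.m i)) else 0) +
        (if l = i then ε i • (C.coord i (p i) : AddCircle (C.ell i + C.m i)) else 0) := by
      intro l
      rcases lt_trichotomy l i with h | h | h
      · rw [coord_of_pos_lt (by rw [hpos]; rw [Fin.lt_def] at h; omega), if_pos (Fin.lt_def.1 h),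
          if_neg h.ne]
        simp
      · subst h; simp
      · rw [coord_of_lt_pos (by rw [hpos]; rw [Fin.lt_def] at h; omega),
          if_neg (by rw [Fin.lt_def] at h; omega), if_neg h.ne']
        simp
    simp only [Z, map_sum, jac_single]
    rw [Finset.sum_congr rfl fun l _ => hterm l, Finset.sum_add_distrib,
      Fin.sum_ite_lt i.2.le (fun l => (-ε l) • (C.ell i : AddCircle (C.ell i + C.m i))),
      ← Finset.sum_smul, Finset.sum_neg_distrib, hε i i.2.le]
    simp only [Finset.sum_ite_eq', Finset.mem_univ, if_true]
    -- If bead `j` climbs, `Climb` says that the equation on this loop holds without a chip;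
    -- otherwise the chosen chip makes it hold.
    obtain ⟨k, hk, hUk, hk1, hk2⟩ := T.step i i.2
    by_cases h : j = k
    · subst h
      obtain ⟨_, hUk⟩ := hUk
      have : ε i = 0 := by simp only [ε]; omega
      change C.jac i D = _ • (C.ell i : AddCircle (C.ell i + C.m i)) at hUk
      rw [this, zero_zsmul, add_zero, hUk, hdeg, ← natCast_zsmul, ← add_smul]
      congr 1
      ring
    · have : ε i = 1 := by simp only [ε]; rw [hk2 j hj h]; ring
      rw [this, one_zsmul, hcoord, add_left_comm, ← add_smul, ← natCast_zsmul]
      congr 2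
      ring
  refine ⟨Z + C.endDivisor hg r j, (isDistinguished_iff hg).2 ⟨equivalent_of_jac_eq ?_ ?_, ?_⟩⟩
  · rw [degree_add, degree_endDivisor, hdZ, hdeg]; ring
  · intro i
    rw [map_add, hjZ, jac_endDivisor, neg_zsmul, natCast_zsmul, add_neg_cancel_right]
  · rwa [add_sub_cancel_right]

theorem existsUnique_isDistinguished (hg : 0 < g)
    (T : IsTableau g r t (Climb D) lam) (hU : Sparse g (Climb D)) (hdeg : degree D = g + r - t)
    {j : ℕ} (hj : j ≤ r) : ∃! D', C.IsDistinguished hg D r j D' := by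
  obtain ⟨D', h⟩ := exists_isDistinguished hg T hdeg hj
  exact ⟨D', h, fun D'' h' => IsDistinguished.unique T hU hdeg hj h' h⟩

end

/-- The residual divisor climbs where the holes fall. -/
theorem climb_residual (hg : 0 < g) {D E : C.graph.Divisor}
    (hE : Equivalent E (C.graph.canonical - D)) :
    Climb E = fun i z => Climb D i (-z - 2) := by
  have hdeg : degree E = 2 * g - 2 - degree D := by
    rw [degree_eq_of_equivalent hE, degree_sub, degree_canonical hg]
  ext i z
  refine exists_congr fun h => ?_
  rw [jac_eq_of_equivalent hE, map_sub, jac_canonical, hdeg, sub_eq_iff_eq_add,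
    ← sub_eq_iff_eq_add', ← sub_smul, eq_comm]
  refine Eq.congr_right (congrArg (· • _) ?_)
  simp only
  ring

end ChainOfLoops

/-- After adding the constants `b`, the minimum of the functions `F a` with `a ∈ S` is attained at
least twice everywhere. -/
def MinTwice {ι X : Type*} (S : Finset ι) (F : ι → X → ℝ) (b : ι → ℝ) : Prop :=
  ∀ p, ∃ a ∈ S, ∃ a' ∈ S, a ≠ a' ∧ (∀ c ∈ S, F a p + b a ≤ F c p + b c) ∧
    ∀ c ∈ S, F a' p + b a' ≤ F c p + b c

namespace MetricGraph

variable {G : MetricGraph}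

theorem kinkSum_le {Z : G.Divisor} {e : G.E}
    (hZ : ∀ x h0 h1, 0 ≤ Z (Point.interior e x h0 h1)) :
    kinkSum Z e (G.len e) ≤ edgeDegree e Z * G.len e := by
  rw [kinkSum, edgeDegree]
  push_cast
  rw [Finset.sum_mul]
  refine Finset.sum_le_sum fun p _ => ?_
  cases p with
  | vertex v => simp [kink, before]
  | interior e' x h0 h1 =>
    by_cases h : e' = e
    · subst h
      have : (0 : ℝ) ≤ Z (Point.interior e' x h0 h1) := by exact_mod_cast hZ x h0 h1
      simp only [kink, before, if_true, h1, and_self]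
      rw [max_eq_left (by linarith)]
      push_cast
      nlinarith
    · simp [kink, before, h]

end MetricGraph

namespace ChainOfLoops

open MetricGraph

variable {g : ℕ} {C : ChainOfLoops g}

/-! ### Functions relating effective canonical divisors -/

/-- A function `f` from the canonical divisor to an effective divisor `T` without chips on the
bridges. The slope on the bridge before the `i`th loop is `α i`; the values `α 0` and `α g` record
the multiplicities of `T` at the ends. -/
structure IsBridgeLinear (hg : 0 < g) (f : C.graph.Point → ℝ) (T : C.graph.Divisor)
    (α : ℕ → ℤ) : Prop where
  moves : Moves f C.graph.canonical T
  nonneg : 0 ≤ T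
  odd : ∀ i, i + 1 < g → C.degBefore (2 * i + 1) T = 2 * i + 1 - α (i + 1)
  even : ∀ i, i + 1 < g → C.degBefore (2 * i + 2) T = 2 * i + 1 - α (i + 1)
  left : -1 - α 0 ≤ T (C.leftEnd hg)
  right : α g - 1 ≤ T (C.rightEnd hg)

namespace IsBridgeLinear

variable {hg : 0 < g} {f : C.graph.Point → ℝ} {T : C.graph.Divisor} {α : ℕ → ℤ}

theorem ord_eq (h : IsBridgeLinear hg f T α) (p : C.graph.Point) :
    C.graph.ord f p = (T - C.graph.canonical) p := by
  rw [Finsupp.sub_apply, ← h.moves.2]; ring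

/-- Neither `T` nor the canonical divisor has chips inside the bridge, so `f` is linear there, with
slope given by the degrees to the left. -/
theorem apply_bridge (h : IsBridgeLinear hg f T α) {i : ℕ} (hi : i + 1 < g) :
    ∃ L : ℝ, 0 < L ∧
      f (C.vtxL ⟨i + 1, hi⟩) = f (C.vtxR ⟨i, by omega⟩) + α (i + 1) * L := by
  have hi' : i < g - 1 := by omega
  refine ⟨C.graph.len (C.bri ⟨i, hi'⟩), C.graph.len_pos _, ?_⟩
  have h1 := h.moves.1.apply_tgt h.ord_eq (C.bri ⟨i, hi'⟩)
  have h2 := slopeOut_eq h.moves.1 h.ord_eq (i := i) (by omega)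
  rw [slopeOut, dif_pos hi', map_sub, h.odd i hi, degBefore_canonical hi] at h2
  rw [h2, kinkSum_eq_zero] at h1
  · rw [sub_zero] at h1
    refine h1.trans ?_
    push_cast
    refine congrArg₂ (· + ·) rfl ?_
    ring
  · intro x h0 h1
    rw [Finsupp.sub_apply, canonical_interior, sub_zero]
    exact eq_zero_of_degBefore h.nonneg (c := 2 * i + 1) (by rw [h.odd i hi, h.even i hi]) rfl

/-- The canonical divisor has a single chip at an inner left vertex and `T` is effective. At the
first vertex it has none, and the field `left` provides the bound. -/
theorem startSlope_add_le (h : IsBridgeLinear hg f T α) (i : Fin g) :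
    startSlope f (C.top i) + startSlope f (C.bot i) ≤ 1 + α i := by
  have h1 := h.ord_eq (C.vtxL i)
  rw [ord_vtxL, slopeIn_eq h.moves.1 h.ord_eq i.2, Finsupp.sub_apply, canonical_vtxL,
    map_sub] at h1
  have h2 : 0 ≤ T (C.vtxL i) := h.nonneg _
  obtain ⟨i, hi⟩ := i
  rcases i with _ | i
  · have h3 := h.left
    rw [leftEnd_eq] at h3
    simp at h1
    simp only
    omega
  · have e1 := h.even i hi
    have e2 := degBefore_canonical_even (C := C) hi
    simp only [Nat.add_eq_zero_iff, one_ne_zero, and_false, if_false] at h1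
    rw [show 2 * (i + 1) = 2 * i + 2 by ring, e1, e2] at h1
    simp only
    omega

theorem le_endSlope_add (h : IsBridgeLinear hg f T α) (i : Fin g) :
    α (i + 1) - 1 ≤ endSlope f (C.top i) + endSlope f (C.bot i) := by
  have h1 := h.ord_eq (C.vtxR i)
  rw [ord_vtxR, slopeOut_eq h.moves.1 h.ord_eq i.2, Finsupp.sub_apply, canonical_vtxR] at h1
  have h2 : 0 ≤ T (C.vtxR i) := h.nonneg _
  by_cases hi : i.1 + 1 = g
  · rw [if_pos hi, C.degBefore_eq_degree (by omega), degree_eq_zero_of_ord h.moves.1 h.ord_eq] at h1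
    have h3 := h.right
    rw [rightEnd_eq] at h3
    have : i = ⟨g - 1, by omega⟩ := Fin.ext (by simp only; omega)
    rw [← this] at h3
    rw [hi]
    omega
  · have hi' : i.1 + 1 < g := by have := i.2; omega
    rw [if_neg hi, map_sub, h.odd _ hi', degBefore_canonical hi'] at h1
    omega

theorem interior_nonneg (h : IsBridgeLinear hg f T α) (e x h0 h1) :
    0 ≤ (T - C.graph.canonical) (Point.interior e x h0 h1) := by
  rw [Finsupp.sub_apply, canonical_interior, sub_zero]
  exact h.nonneg _

/-- On both edges `f` is concave, so not decreasing from left to right forces nonnegative initial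
slopes. Their sum is at most `1 + α i ≤ 0`; hence both vanish and no chips bend `f` inside the loop.
-/
theorem of_left_le (h : IsBridgeLinear hg f T α) {i : Fin g} (hα : α i < 0)
    (hle : f (C.vtxL i) ≤ f (C.vtxR i)) :
    α i = -1 ∧ α (i + 1) ≤ 1 ∧ f (C.vtxR i) = f (C.vtxL i) := by
  have t1 := apply_vtxR_top h.moves.1 h.ord_eq i
  have t2 := apply_vtxR_bot h.moves.1 h.ord_eq i
  have k1 : 0 ≤ kinkSum (T - C.graph.canonical) (C.top i) (C.ell i) :=
    kinkSum_nonneg (h.interior_nonneg _)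
  have k2 : 0 ≤ kinkSum (T - C.graph.canonical) (C.bot i) (C.m i) :=
    kinkSum_nonneg (h.interior_nonneg _)
  have s1 : 0 ≤ startSlope f (C.top i) := by
    have : (0 : ℝ) ≤ startSlope f (C.top i) * C.ell i := by linarith
    exact_mod_cast nonneg_of_mul_nonneg_left this (C.ell_pos i)
  have s2 : 0 ≤ startSlope f (C.bot i) := by
    have : (0 : ℝ) ≤ startSlope f (C.bot i) * C.m i := by linarith
    exact_mod_cast nonneg_of_mul_nonneg_left this (C.m_pos i)
  have h1 := h.startSlope_add_le i
  have z1 : startSlope f (C.top i) = 0 := by omega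
  have z2 : startSlope f (C.bot i) = 0 := by omega
  rw [z1, Int.cast_zero, zero_mul, add_zero] at t1
  rw [z2, Int.cast_zero, zero_mul, add_zero] at t2
  have h2 := h.le_endSlope_add i
  rw [h.moves.1.endSlope_eq h.ord_eq, h.moves.1.endSlope_eq h.ord_eq, z1, z2,
    edgeDegree_eq_zero (h.interior_nonneg _) (show kinkSum _ (C.top i) (C.ell i) = 0 by linarith),
    edgeDegree_eq_zero (h.interior_nonneg _) (show kinkSum _ (C.bot i) (C.m i) = 0 by linarith)]
    at h2
  exact ⟨by omega, by omega, by linarith⟩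

/-- The mirror image of `of_left_le`, read through the final slopes. What it omits follows from
`of_left_le` once the values at the two vertices agree. -/
theorem of_right_le (h : IsBridgeLinear hg f T α) {i : Fin g} (hα : 0 < α (i + 1))
    (hle : f (C.vtxR i) ≤ f (C.vtxL i)) : α (i + 1) = 1 ∧ f (C.vtxL i) = f (C.vtxR i) := by
  have t1 := apply_vtxR_top h.moves.1 h.ord_eq i
  have t2 := apply_vtxR_bot h.moves.1 h.ord_eq i
  have k1 : kinkSum (T - C.graph.canonical) (C.top i) (C.ell i) ≤ _ :=
    kinkSum_le (h.interior_nonneg _)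
  have k2 : kinkSum (T - C.graph.canonical) (C.bot i) (C.m i) ≤ _ :=
    kinkSum_le (h.interior_nonneg _)
  have e1 := h.moves.1.endSlope_eq h.ord_eq (C.top i)
  have e2 := h.moves.1.endSlope_eq h.ord_eq (C.bot i)
  rw [eq_sub_iff_add_eq] at e1 e2
  rw [← e1] at t1
  rw [← e2] at t2
  rw [len_top] at k1
  rw [len_bot] at k2
  push_cast at t1 t2
  rw [add_mul] at t1 t2
  have s1 : endSlope f (C.top i) ≤ 0 := by
    have : (endSlope f (C.top i) : ℝ) * C.ell i ≤ 0 := by linarith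
    exact_mod_cast nonpos_of_mul_nonpos_left this (C.ell_pos i)
  have s2 : endSlope f (C.bot i) ≤ 0 := by
    have : (endSlope f (C.bot i) : ℝ) * C.m i ≤ 0 := by linarith
    exact_mod_cast nonpos_of_mul_nonpos_left this (C.m_pos i)
  have h2 := h.le_endSlope_add i
  have z1 : endSlope f (C.top i) = 0 := by omega
  rw [z1, Int.cast_zero, zero_mul, zero_add] at t1
  exact ⟨by omega, by linarith⟩

end IsBridgeLinear

/-- Functions with distinct behaviour at every loop are tropically independent. -/
theorem not_minTwice {ι : Type*} {hg : 0 < g} {S : Finset ι} {F : ι → C.graph.Point → ℝ}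
    {T : ι → C.graph.Divisor} {α : ι → ℕ → ℤ} (hF : ∀ a, IsBridgeLinear hg (F a) (T a) (α a))
    (hne : ∀ a, ∀ i ≤ g, α a i ≠ 0) (h0 : ∀ a, α a 0 < 0) (hlast : ∀ a, 0 < α a g)
    (huniq : ∀ i < g, ∀ a a', α a i = -1 → α a (i + 1) = 1 → α a' i = -1 → α a' (i + 1) = 1 →
      a = a') (b : ι → ℝ) : ¬ MinTwice S F b := by
  intro hmin
  -- If no loop works, negativity of the slopes of all minimizers propagates from left vertex to
  -- left vertex: a minimizer leaving a loop with nonpositive slope stays below any function of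
  -- positive slope across the bridge. At the right end this contradicts `hlast`.
  have hloop : ∃ i : Fin g,
      (∀ a ∈ S, (∀ c ∈ S, F a (C.vtxL i) + b a ≤ F c (C.vtxL i) + b c) → α a i < 0) ∧
      ∀ a ∈ S, (∀ c ∈ S, F a (C.vtxR i) + b a ≤ F c (C.vtxR i) + b c) → 0 < α a (i + 1) := by
    by_contra! hcon
    have hind : ∀ i (hi : i < g), ∀ a ∈ S,
        (∀ c ∈ S, F a (C.vtxL ⟨i, hi⟩) + b a ≤ F c (C.vtxL ⟨i, hi⟩) + b c) → α a i < 0 := by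
      intro i
      induction i with
      | zero => exact fun _ a _ _ => h0 a
      | succ i ih =>
        intro hi a ha hamin
        obtain ⟨c, hc, hcmin, hcα⟩ := hcon ⟨i, by omega⟩ (ih (by omega))
        by_contra hpos
        have hpos : 0 < α a (i + 1) := lt_of_le_of_ne (not_lt.1 hpos) (hne a _ hi.le).symm
        obtain ⟨L, hL, ea⟩ := (hF a).apply_bridge hi
        obtain ⟨L', hL', ec⟩ := (hF c).apply_bridge hi
        have m1 := hamin c hc
        have m2 := hcmin a ha
        rw [ea, ec] at m1
        have p1 : (0 : ℝ) < α a (i + 1) := by exact_mod_cast hpos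
        have p2 : (α c (i + 1) : ℝ) ≤ 0 := by exact_mod_cast hcα
        nlinarith [mul_pos p1 hL, mul_nonneg (neg_nonneg.2 p2) hL'.le]
    obtain ⟨c, hc, hcmin, hcα⟩ := hcon ⟨g - 1, by omega⟩ (hind (g - 1) (by omega))
    rw [show (⟨g - 1, by omega⟩ : Fin g).1 + 1 = g by simp only; omega] at hcα
    exact absurd (hlast c) (not_lt.2 hcα)
  obtain ⟨i, hL, hR⟩ := hloop
  obtain ⟨a, ha, a', ha', haa, hma, hma'⟩ := hmin (C.vtxL i)
  obtain ⟨c, hc, c', hc', hcc, hmc, hmc'⟩ := hmin (C.vtxR i)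
  -- Start from the vertex with the lower minimum. Its minimizers cannot descend across the loop, so
  -- they are level, remain minimizers at the other vertex, and jump from `-1` to `1`.
  rcases le_total (F a (C.vtxL i) + b a) (F c (C.vtxR i) + b c) with hle | hle
  · have key : ∀ x ∈ S, (∀ y ∈ S, F x (C.vtxL i) + b x ≤ F y (C.vtxL i) + b y) →
        α x i = -1 ∧ α x (i + 1) = 1 := by
      intro x hx hmx
      have h1 := hmx a ha
      have h2 := hmc x hx
      obtain ⟨e1, e2, e3⟩ := (hF x).of_left_le (hL x hx hmx) (by linarith)
      have h3 := hR x hx fun y hy => by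
        have := hmc y hy
        rw [e3]; linarith
      exact ⟨e1, by omega⟩
    exact haa (huniq i i.2 a a' (key a ha hma).1 (key a ha hma).2 (key a' ha' hma').1
      (key a' ha' hma').2)
  · have key : ∀ x ∈ S, (∀ y ∈ S, F x (C.vtxR i) + b x ≤ F y (C.vtxR i) + b y) →
        α x i = -1 ∧ α x (i + 1) = 1 := by
      intro x hx hmx
      have h1 := hmx c hc
      have h2 := hma x hx
      obtain ⟨e1, e2⟩ := (hF x).of_right_le (hR x hx hmx) (by linarith)
      have h3 := hL x hx fun y hy => by
        have := hma y hy
        rw [e2]; linarith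
      exact ⟨((hF x).of_left_le h3 e2.le).1, e1⟩
    exact hcc (huniq i i.2 c c' (key c hc hmc).1 (key c hc hmc).2 (key c' hc' hmc').1
      (key c' hc' hmc').2)

end ChainOfLoops

/-! ### Injectivity of the multiplication map -/

/-- If the tropicalizations of the products of the elements of two bases are tropically
independent, together with all their subfamilies, the multiplication map is injective. -/
theorem mulMap_injective_of_not_minTwice {X : Type*} {ι κ : Type*} [Fintype ι] [Fintype κ]
    {K L : Type*} [Field K] [Field L] [Algebra K L] {φ : ι → X → ℝ} {ψ : κ → X → ℝ}
    (hmin : ∀ (S : Finset (ι × κ)) (b : ι × κ → ℝ),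
      ¬ MinTwice S (fun a p => φ a.1 p + ψ a.2 p) b)
    (val : AddValuation K (WithTop ℝ)) (valAt : X → AddValuation L (WithTop ℝ))
    {A B : Submodule K L} (a : Module.Basis ι K A) (b : Module.Basis κ K B)
    (hval : ∀ p c, valAt p (algebraMap K L c) = val c)
    (ha : ∀ j p, valAt p (a j : L) = (φ j p : WithTop ℝ))
    (hb : ∀ k p, valAt p (b k : L) = (ψ k p : WithTop ℝ)) :
    Function.Injective (Submodule.mulMap A B) := by
  classical
  refine (Submodule.LinearDisjoint.of_basis_mul A B a b ?_).injective
  rw [Fintype.linearIndependent_iff]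
  intro c hc
  by_contra! hex
  obtain ⟨x₀, hx₀⟩ := hex
  -- Zero coefficients have infinite valuation and drop out, which is why independence of all
  -- subfamilies is needed.
  let S : Finset (ι × κ) := Finset.univ.filter fun x => c x ≠ 0
  have hS : ∀ {x}, x ∈ S ↔ c x ≠ 0 := by simp [S]
  let β : ι × κ → ℝ := fun x => (val (c x)).untopD 0
  have hβ : ∀ x ∈ S, val (c x) = (β x : WithTop ℝ) := by
    intro x hx
    have : val (c x) ≠ ⊤ := fun h => hS.1 hx (val.top_iff.1 h)
    obtain ⟨y, hy⟩ := WithTop.ne_top_iff_exists.1 this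
    simp [β, ← hy]
  let term : ι × κ → L := fun x => c x • ((a x.1 : L) * b x.2)
  have hterm : ∀ p, ∀ x ∈ S, valAt p (term x) =
      ((φ x.1 p + ψ x.2 p + β x : ℝ) : WithTop ℝ) := by
    intro p x hx
    simp only [term]
    rw [Algebra.smul_def, AddValuation.map_mul, AddValuation.map_mul, hval, ha, hb, hβ x hx]
    norm_cast
    ring
  have hsum : ∑ x ∈ S, term x = 0 := by
    rw [← hc]
    refine Finset.sum_subset (Finset.subset_univ S) fun x _ hx => ?_
    have : c x = 0 := by by_contra h; exact hx (hS.2 h)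
    simp only [term, this, zero_smul]
  refine hmin S β fun p => ?_
  obtain ⟨x, hx, hxmin⟩ := S.exists_min_image (fun x => φ x.1 p + ψ x.2 p + β x) ⟨x₀, hS.2 hx₀⟩
  obtain ⟨y, hy, hyx, hle⟩ : ∃ y ∈ S, y ≠ x ∧
      φ y.1 p + ψ y.2 p + β y ≤ φ x.1 p + ψ x.2 p + β x := by
    by_contra! hcon
    rw [← Finset.add_sum_erase S term hx] at hsum
    -- A strictly smallest valuation cannot be cancelled by the remaining terms.
    have h1 : valAt p (term x) < valAt p (∑ y ∈ S.erase x, term y) := by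
      refine AddValuation.map_lt_sum _ (by rw [hterm p x hx]; exact WithTop.coe_ne_top) ?_
      intro y hy
      rw [Finset.mem_erase] at hy
      rw [hterm p x hx, hterm p y hy.2]
      exact_mod_cast hcon y hy.2 hy.1
    rw [eq_neg_of_add_eq_zero_left hsum, AddValuation.map_neg] at h1
    exact lt_irrefl _ h1
  exact ⟨x, hx, y, hy, hyx.symm, hxmin, fun z hz => hle.trans (hxmin z hz)⟩

namespace ChainOfLoops

open MetricGraph

variable {g : ℕ} {C : ChainOfLoops g}

/-! ### The products of distinguished functions -/

section

variable {hg : 0 < g} {r t : ℕ} {D E : C.graph.Divisor} {lam : ℕ → ℕ → ℤ}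

theorem IsDistinguished.degBefore_eq
    (T : IsTableau g r t (Climb D) lam) (hU : Sparse g (Climb D)) (hdeg : degree D = g + r - t)
    {j : ℕ} (hj : j ≤ r) {D' : C.graph.Divisor} (h : C.IsDistinguished hg D r j D') {i : ℕ}
    (hi : i + 1 < g) :
    C.degBefore (2 * i + 1) D' = r - t + (i + 1) - lam (i + 1) j ∧
      C.degBefore (2 * i + 2) D' = r - t + (i + 1) - lam (i + 1) j := by
  have h1 := IsDistinguished.degBefore_sub T hU hdeg hj h hi.le
  have h2 := IsDistinguished.degBefore_sub_odd T hU hdeg hj h (i := i) (by omega)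
  rw [h1, map_sub, degBefore_endDivisor _ _ _ (by omega) (by omega)] at h2
  rw [map_sub, degBefore_endDivisor _ _ _ (by omega) (by omega),
    show 2 * (i + 1) = 2 * i + 2 by ring] at h1
  push_cast at h1 h2
  constructor <;> omega

theorem IsDistinguished.nonneg {n j : ℤ} {D' : C.graph.Divisor}
    (h : C.IsDistinguished hg D n j D') (h0 : 0 ≤ j) (hn : j ≤ n) : 0 ≤ D' := by
  have h1 := ((isDistinguished_iff hg).1 h).2
  have h2 : 0 ≤ C.endDivisor hg n j :=
    add_nonneg (Finsupp.single_nonneg.2 h0) (Finsupp.single_nonneg.2 (by omega))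
  have := add_nonneg h1 h2
  rwa [sub_add_cancel] at this

theorem IsDistinguished.le_left {n j : ℤ} {D' : C.graph.Divisor}
    (h : C.IsDistinguished hg D n j D') : j ≤ D' (C.leftEnd hg) := by
  classical
  have h1 := ((isDistinguished_iff hg).1 h).2 (C.leftEnd hg)
  simp only [Finsupp.coe_zero, Pi.zero_apply, endDivisor, Finsupp.sub_apply, Finsupp.add_apply,
    Finsupp.single_apply, if_true, leftEnd_eq, rightEnd_eq, vtxR_ne_vtxL, if_false] at h1
  rw [leftEnd_eq]
  omega

theorem IsDistinguished.le_right {n j : ℤ} {D' : C.graph.Divisor}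
    (h : C.IsDistinguished hg D n j D') : n - j ≤ D' (C.rightEnd hg) := by
  classical
  have h1 := ((isDistinguished_iff hg).1 h).2 (C.rightEnd hg)
  simp only [Finsupp.coe_zero, Pi.zero_apply, endDivisor, Finsupp.sub_apply, Finsupp.add_apply,
    Finsupp.single_apply, if_true, leftEnd_eq, rightEnd_eq, vtxL_ne_vtxR, if_false] at h1
  rw [rightEnd_eq]
  omega

/-- The functions `φ_j + ψ_k` are tropically independent, together with all their subfamilies. -/
theorem not_minTwice_of_isTableau (T : IsTableau g r t (Climb D) lam) (hU : Sparse g (Climb D))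
    (hdeg : degree D = g + r - t) (ht : 0 < t)
    (hE : Equivalent E (C.graph.canonical - D))
    {Dj : Fin (r + 1) → C.graph.Divisor} {Ek : Fin t → C.graph.Divisor}
    {φ : Fin (r + 1) → C.graph.Point → ℝ} {ψ : Fin t → C.graph.Point → ℝ}
    (hD : ∀ j : Fin (r + 1), C.IsDistinguished hg D r (j : ℕ) (Dj j))
    (hE' : ∀ k : Fin t, C.IsDistinguished hg E ((t : ℤ) - 1) (k : ℕ) (Ek k))
    (hφ : ∀ j, Moves (φ j) D (Dj j)) (hψ : ∀ k, Moves (ψ k) E (Ek k))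
    (S : Finset (Fin (r + 1) × Fin t)) (b : Fin (r + 1) × Fin t → ℝ) :
    ¬ MinTwice S (fun a p => φ a.1 p + ψ a.2 p) b := by
  have T' := T.dual hU ht
  have hU' := hU.dual
  rw [← climb_residual hg hE] at T' hU'
  have hdegE : degree E = g + (t - 1 : ℕ) - (r + 1 : ℕ) := by
    rw [degree_eq_of_equivalent hE, degree_sub, degree_canonical hg, hdeg]
    push_cast [ht]; ring
  have hcast : ((t - 1 : ℕ) : ℤ) = t - 1 := by push_cast [ht]; ring
  have hcomp := fun {i : ℕ} (hi : i ≤ g) => T.complementary hU hi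
  set lam' : ℕ → ℕ → ℤ := fun i k => -hole (r - t) (Climb D) i k - 1 with hlam'
  obtain ⟨χ, hχ, hχ'⟩ := hE
  -- Subtracting the common function `χ` does not change which indices attain the minimum, and makes
  -- the canonical divisor the starting point.
  have hmove : Moves χ (D + E) C.graph.canonical := ⟨hχ, fun p => by
    have := hχ' p
    rw [Finsupp.sub_apply] at this
    rw [Finsupp.add_apply]; omega⟩
  -- The slope `α` is the level of the bead minus the level of the hole. Its values at `0` and `g`
  -- are `-(j + k + 1)` and `(r - j) + (t - 1 - k) + 1`, matching the chips at the ends.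
  have hlin : ∀ a : Fin (r + 1) × Fin t, IsBridgeLinear hg (-χ + (φ a.1 + ψ a.2))
      (Dj a.1 + Ek a.2) fun i => lam i a.1 + lam' i a.2 + 1 := by
    rintro ⟨j, k⟩
    have hj : j.1 ≤ r := by omega
    have hk : k.1 ≤ t - 1 := by omega
    have hEk := hE' k
    rw [← hcast] at hEk
    have hd := fun {i : ℕ} (hi : i + 1 < g) =>
      IsDistinguished.degBefore_eq T hU hdeg hj (hD j) hi
    have he := fun {i : ℕ} (hi : i + 1 < g) =>
      IsDistinguished.degBefore_eq T' hU' hdegE hk hEk hi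
    refine ⟨hmove.symm.trans ((hφ j).add (hψ k)), add_nonneg ((hD j).nonneg (by omega) (by omega))
      (hEk.nonneg (by omega) (by omega)), fun i hi => ?_, fun i hi => ?_, ?_, ?_⟩
    · rw [map_add, (hd hi).1, (he hi).1]; push_cast [ht]; ring
    · rw [map_add, (hd hi).2, (he hi).2]; push_cast [ht]; ring
    · have h1 := (hD j).le_left
      have h2 := hEk.le_left
      rw [Finsupp.add_apply, T.start j hj, T'.start k hk]
      push_cast [ht]
      omega
    · have h1 := (hD j).le_right
      have h2 := hEk.le_right
      rw [Finsupp.add_apply, T.finish j hj, T'.finish k hk]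
      simp only
      omega
  have hnot := not_minTwice (S := S) hlin (fun a i hi => ?_) (fun a => ?_) (fun a => ?_)
    (fun i hi a a' h1 h2 h3 h4 => ?_) b
  · intro h
    refine hnot fun p => ?_
    obtain ⟨a, ha, a', ha', hne, h1, h2⟩ := h p
    refine ⟨a, ha, a', ha', hne, fun c hc => ?_, fun c hc => ?_⟩
    · have := h1 c hc
      simp only [Pi.add_apply, Pi.neg_apply]
      linarith
    · have := h2 c hc
      simp only [Pi.add_apply, Pi.neg_apply]
      linarith
  · have := (hcomp hi).disjoint a.1 (by omega) a.2 a.2.2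
    simp only [hlam']
    omega
  · rw [T.start _ (by omega), T'.start _ (by omega)]
    push_cast [ht]
    omega
  · rw [T.finish _ (by omega), T'.finish _ (by omega)]
    omega
  -- A jump by two requires the bead to climb and the hole to fall at the same time, which singles
  -- out the pair.
  · obtain ⟨j, hj, -, -, hj'⟩ := T.step i hi
    obtain ⟨k, hk, -, -, hk'⟩ := T'.step i hi
    have key : ∀ a : Fin (r + 1) × Fin t, lam i a.1 + lam' i a.2 + 1 = -1 →
        lam (i + 1) a.1 + lam' (i + 1) a.2 + 1 = 1 → a.1.1 = j ∧ a.2.1 = k := by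
      intro a h1 h2
      have b1 := T.succ_le hi (k := a.1) (by omega)
      have b2 := T'.succ_le hi (k := a.2) (by omega)
      constructor
      · by_contra hne
        have := hj' a.1 (by omega) hne
        omega
      · by_contra hne
        have := hk' a.2 (by omega) hne
        omega
    obtain ⟨e1, e2⟩ := key a h1 h2
    obtain ⟨e3, e4⟩ := key a' h3 h4
    exact Prod.ext (Fin.ext (e1.trans e3.symm)) (Fin.ext (e2.trans e4.symm))

end

end ChainOfLoops

/-! ### The main theorem -/

theorem mainTheorem2 (g : ℕ) (hg : 0 < g) (C : ChainOfLoops g) (hC : C.Generic)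
    (r : ℕ) (d : ℤ) (hρ : brillNoetherNumber g r d = 0)
    (t : ℕ) (ht : (t : ℤ) = g - d + r)
    (D E : C.graph.Divisor)
    (hdeg : MetricGraph.degree D = d) (hrank : MetricGraph.RankAtLeast D r)
    (hE : MetricGraph.Equivalent E (C.graph.canonical - D)) :
    -- the divisors `D_j` and `E_k` exist and are unique
    (∀ j : Fin (r + 1), ∃! D' : C.graph.Divisor, C.IsDistinguished hg D r (j : ℕ) D') ∧
    (∀ k : Fin t, ∃! E' : C.graph.Divisor, C.IsDistinguished hg E ((t : ℤ) - 1) (k : ℕ) E') ∧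
    ∀ (Dj : Fin (r + 1) → C.graph.Divisor) (Ek : Fin t → C.graph.Divisor)
      (φ : Fin (r + 1) → C.graph.Point → ℝ) (ψ : Fin t → C.graph.Point → ℝ),
      (∀ j : Fin (r + 1), C.IsDistinguished hg D r (j : ℕ) (Dj j)) →
      (∀ k : Fin t, C.IsDistinguished hg E ((t : ℤ) - 1) (k : ℕ) (Ek k)) →
      (∀ j, MetricGraph.Moves (φ j) D (Dj j)) →
      (∀ k, MetricGraph.Moves (ψ k) E (Ek k)) →
      -- the functions `φ_j + ψ_k` are `g` in number and tropically independent
      (Fintype.card (Fin (r + 1) × Fin t) = g ∧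
        MetricGraph.TropicallyIndependent
          (fun (jk : Fin (r + 1) × Fin t) p => φ jk.1 p + ψ jk.2 p)) ∧
      -- multiplication is injective if `φ_j`, `ψ_k` are the tropicalizations of bases `a_j`, `b_k`
      -- of spaces of rational functions, the points of the graph being valuations on the field `L`
      ∀ (K : Type*) (L : Type*) [Field K] [Field L] [Algebra K L]
        (val : AddValuation K (WithTop ℝ)) (valAt : C.graph.Point → AddValuation L (WithTop ℝ))
        (A B : Submodule K L) (a : Module.Basis (Fin (r + 1)) K A) (b : Module.Basis (Fin t) K B),
        (∀ p c, valAt p (algebraMap K L c) = val c) →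
        (∀ j p, valAt p (a j : L) = (φ j p : WithTop ℝ)) →
        (∀ k p, valAt p (b k : L) = (ψ k p : WithTop ℝ)) →
        Function.Injective (Submodule.mulMap A B) := by
  have card : (r + 1) * t = g := by
    rw [brillNoetherNumber, ← ht] at hρ
    have : ((r : ℤ) + 1) * t = g := by linarith
    exact_mod_cast this
  have htpos : 0 < t := by
    rcases Nat.eq_zero_or_pos t with rfl | h
    · omega
    · exact h
  have hdeg' : MetricGraph.degree D = g + r - t := by omega
  have hU := ChainOfLoops.sparse_climb hC D
  have T := ChainOfLoops.isTableau_of_rankAtLeast hg hC card hdeg' hrank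
  refine ⟨fun j => ChainOfLoops.existsUnique_isDistinguished hg T hU hdeg' (by omega), fun k => ?_,
    fun Dj Ek φ ψ hD hE' hφ hψ => ?_⟩
  -- For `E` the parameters `r` and `t` become `t - 1` and `r + 1`.
  · have T' := T.dual hU htpos
    have hU' := hU.dual
    rw [← ChainOfLoops.climb_residual hg hE] at T' hU'
    have hdegE : MetricGraph.degree E = g + (t - 1 : ℕ) - (r + 1 : ℕ) := by
      rw [ChainOfLoops.degree_eq_of_equivalent hE, ChainOfLoops.degree_sub,
        ChainOfLoops.degree_canonical hg, hdeg']
      push_cast [htpos]; ring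
    have := ChainOfLoops.existsUnique_isDistinguished hg T' hU' hdegE (j := k) (by omega)
    rwa [show ((t - 1 : ℕ) : ℤ) = t - 1 by push_cast [htpos]; ring] at this
  · have hnot := ChainOfLoops.not_minTwice_of_isTableau T hU hdeg' htpos hE hD hE' hφ hψ
    refine ⟨⟨by simp [card], ?_⟩, ?_⟩
    · rintro ⟨b, hb⟩
      refine hnot Finset.univ b fun p => ?_
      obtain ⟨a, a', hne, h1, h2⟩ := hb p
      exact ⟨a, Finset.mem_univ _, a', Finset.mem_univ _, hne, fun c _ => h1 c, fun c _ => h2 c⟩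
    · intro K L _ _ _ val valAt A B a b hval ha hb
      exact mulMap_injective_of_not_minTwice hnot val valAt a b hval ha hb

end
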